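/- **Setting.** Let $n\ge 1$ and, for $i\in[n]=\{1,\dots,n\}$, let $v_i:[0,\infty)\to[0,\infty)$ (the computation power of worker $i$) be continuous almost everywhere with $V_i(t):=\int_0^t v_i(\tau)\,d\tau<\infty$ for all $t<\infty$; also put $V_i(\infty):=\int_0^\infty v_i(\tau)\,d\tau\in[0,\infty]$. *Algorithms.* A zero-respecting algorithm in $\mathbb R^d$ is a sequence $A=\{A^k\}_{k\ge0}$ of maps $A^k:(\mathbb R^d)^k\to[0,\infty)\times[n]\times\{0,1\}\times\mathbb R^d$ such that, for all $k\ge 0$ and all $g^1,g^2,\dots\in\mathbb R^d$, writing $(t^{k+1},i^{k+1},c^{k+1},x^k)=A^k(g^1,\dots,g^k)$, one has $\operatorname{supp}(x^k)\subseteq\bigcup_{j=1}^k\operatorname{supp}(g^j)$ and $t^{k+2}\ge t^{k+1}$. *Protocol.* Put $t^0=0$ and start every worker in the state $s_i^0=(0,0,0)\in[0,\infty)\times\mathbb R^d\times\{0,1\}$. For $k=0,1,2,\dots$ let $(t^{k+1},i^{k+1},c^{k+1},x^k)=A^k(g^1,\dots,g^k)$ and, with $i=i^{k+1}$, $(s_i^{k+1},g^{k+1})=O_i(t^{k+1},x^k,s_i^k,c^{k+1})$,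 the other states being unchanged, where $$O_i(t,x,(s_t,s_x,s_q),c)=\begin{cases}((t,x,1),\,0), & c=0,\ s_q=0,\\ ((s_t,s_x,1),\,0), & c=0,\ s_q=1,\ V_i(t)-V_i(s_t)<1,\\ ((0,0,0),\,g_i(s_x;\xi^{k+1},t)), & c=0,\ s_q=1,\ V_i(t)-V_i(s_t)\ge1,\\ ((0,0,0),\,0), & c=1,\end{cases}$$ $g_i:\mathbb R^d\times\mathbb S_\xi\times[0,\infty)\to\mathbb R^d$ are the stochastic gradient mappings and $\xi^1,\xi^2,\dots$ are random elements of $\mathbb S_\xi$. **Theorem.** There are universal constants $c',c_1,c_2,c_3>0$ such that the following holds for all $n\ge1$, all $v_1,\dots,v_n$ as above, all $L,\Delta,\varepsilon>0$ and all $\sigma\ge0$ with $\varepsilon<c'L\Delta$. Put $\underline t_0=0$ and, for $k\ge1$, $$\underline t_k=\min\Big\{t\ge0:\Big(\frac1n\sum_{i=1}^n\big\lfloor c_3\,(V_i(t)-V_i(\underline t_{k-1}))\big\rfloor^{-1}\Big)^{-1}\ge\max\Big\{c_2\frac{\sigma^2}{n\varepsilon},1\Big\}\Big\}\in[0,\infty],$$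 with $\min\emptyset=\infty$, $0^{-1}=\infty$, $\infty^{-1}=0$ (and $\underline t_k=\infty$ if $\underline t_{k-1}=\infty$). Then there is a dimension $d$ such that for every zero-respecting algorithm $A$ in $\mathbb R^d$ there are a probability space, random differentiable functions $f_1,\dots,f_n:\mathbb R^d\to\mathbb R$ on it, random elements $\xi^1,\xi^2,\dots$ (on which the $f_i$ may depend) and stochastic gradient mappings $g_1,\dots,g_n$ with the following properties. 1. For every outcome, $f=\frac1n\sum_{i=1}^n f_i$ is differentiable, $\|\nabla f(x)-\nabla f(y)\|\le L\|x-y\|$ for all $x,y\in\mathbb R^d$, and there is $f^*\in\mathbb R$ with $f\ge f^*$ and $f(0)-f^*\le\Delta$. 2. The stochastic gradients are unbiased with variance at most $\sigma^2$: for every $k\ge0$, every $i\in[n]$, every $x\in\mathbb R^d$ and every $t\ge0$ (fixed, or chosen by any rule from $g^1,\dots,g^k$), $$\mathbb E\big[g_i(x;\xi^{k+1},t)\,\big|\,\mathcal H_k(x)\big]=\nabla f_i(x),\qquad \mathbb E\big[\|g_i(x;\xi^{k+1},t)-\nabla f_i(x)\|^2\,\big|\,\mathcal H_k(x)\big]\le\sigma^2$$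 almost surely, where $\mathcal H_k(x)$ is generated by the vectors $g^1,\dots,g^k$ received so far, the true local gradients $\nabla f_j(x^l)$ ($j\in[n]$, $0\le l\le k$), and $\nabla f_1(x),\dots,\nabla f_n(x)$. 3. The protocol satisfies $$\mathbb E\Big[\inf_{k\in S_t}\|\nabla f(x^k)\|^2\Big]>\varepsilon\quad\text{for } t=\tfrac12\,\underline t_{\lfloor c_1L\Delta/\varepsilon\rfloor},\qquad S_t=\{k\in\{0,1,2,\dots\}: t^k\le t\},$$ where the expectation is over all randomness. -/

import Mathlib

open MeasureTheory
open scoped NNReal ENNReal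

noncomputable section

namespace TimeOracle

/-! ### Computation powers -/

/-- `V(t) = ∫₀ᵗ v(τ) dτ` as a map `[0, ∞] → [0, ∞]`. -/
def V (v : ℝ≥0 → ℝ≥0) (t : ℝ≥0∞) : ℝ≥0∞ :=
  ∫⁻ τ in {τ : ℝ | 0 ≤ τ ∧ ENNReal.ofReal τ ≤ t}, (v τ.toNNReal : ℝ≥0∞)

/-- An admissible computation power `v : [0, ∞) → [0, ∞)`: continuous almost everywhere, with
finite integral over every bounded interval `[0, t]`. -/
structure IsComputationPower (v : ℝ≥0 → ℝ≥0) : Prop where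
  continuous_ae : ∀ᵐ τ ∂(volume.restrict (Set.Ici (0 : ℝ))), ContinuousAt v τ.toNNReal
  finite : ∀ t : ℝ≥0, V v t < ⊤

/-- The harmonic mean `((1/n) ∑ᵢ ⌊c₃ (Vᵢ(t) - Vᵢ(s))⌋⁻¹)⁻¹`, in `[0, ∞]`, so that `0⁻¹ = ∞` and
`∞⁻¹ = 0`. For `t < s` the truncated difference and hence the mean are `0`. -/
def harmonicWork {n : ℕ} (v : Fin n → ℝ≥0 → ℝ≥0) (c₃ : ℝ) (s t : ℝ≥0∞) : ℝ≥0∞ :=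
  ((n : ℝ≥0∞)⁻¹ *
    ∑ i, ((⌊c₃ * (V (v i) t - V (v i) s).toReal⌋₊ : ℕ) : ℝ≥0∞)⁻¹)⁻¹

/-- The sequence `t̲₀ = 0`,
`t̲ₖ = min {t ≥ 0 : harmonicWork from t̲ₖ₋₁ to t ≥ max {c₂ σ² / (n ε), 1}}`, with values in
`[0, ∞]` and the convention `min ∅ = ∞`. -/
def lowerTime {n : ℕ} (v : Fin n → ℝ≥0 → ℝ≥0) (c₂ c₃ σ ε : ℝ) : ℕ → ℝ≥0∞
  | 0 => 0
  | k + 1 => sInf {t : ℝ≥0∞ | t ≠ ⊤ ∧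
      ENNReal.ofReal (max (c₂ * (σ ^ 2 / (n * ε))) 1) ≤
        harmonicWork v c₃ (lowerTime v c₂ c₃ σ ε k) t}

/-! ### Algorithms, oracles and the protocol -/

/-- The output `(tᵏ⁺¹, iᵏ⁺¹, cᵏ⁺¹, xᵏ)` of one step of an algorithm. -/
structure Query (n d : ℕ) where
  time : ℝ≥0
  worker : Fin n
  cancel : Bool
  point : EuclideanSpace ℝ (Fin d)

/-- An algorithm is a sequence of maps `Aᵏ`; `Aᵏ` receives the vectors `g¹, …, gᵏ`. -/
abbrev Algorithm (n d : ℕ) : Type :=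
  (k : ℕ) → (Fin k → EuclideanSpace ℝ (Fin d)) → Query n d

/-- Zero-respecting algorithms: the support of `xᵏ` is contained in the union of the supports of
`g¹, …, gᵏ`, and the returned times are nondecreasing. -/
structure IsZeroRespecting {n d : ℕ} (A : Algorithm n d) : Prop where
  support : ∀ (k : ℕ) (g : Fin k → EuclideanSpace ℝ (Fin d)) (c : Fin d),
    (A k g).point c ≠ 0 → ∃ j, g j c ≠ 0
  time_mono : ∀ (k : ℕ) (g : Fin (k + 1) → EuclideanSpace ℝ (Fin d)),
    (A k (Fin.init g)).time ≤ (A (k + 1) g).time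

/-- The state `(s_t, s_x, s_q)` of an oracle. -/
structure OracleState (d : ℕ) where
  time : ℝ≥0
  point : EuclideanSpace ℝ (Fin d)
  busy : Bool

/-- The state `(0, 0, 0)`. -/
def idle (d : ℕ) : OracleState d := ⟨0, 0, false⟩

/-- One call of the oracle of a worker with computation power `v`; `γ x t` is the stochastic
gradient that this call returns if it finishes at time `t` a computation started at `x`. -/
def oracle {d : ℕ} (v : ℝ≥0 → ℝ≥0)
    (γ : EuclideanSpace ℝ (Fin d) → ℝ≥0 → EuclideanSpace ℝ (Fin d))
    (t : ℝ≥0) (x : EuclideanSpace ℝ (Fin d)) (s : OracleState d) (c : Bool) :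
    OracleState d × EuclideanSpace ℝ (Fin d) :=
  open scoped Classical in
  if c = true then (idle d, 0)
  else if s.busy = false then (⟨t, x, true⟩, 0)
  else if V v t - V v s.time < 1 then (s, 0)
  else (idle d, γ s.point t)

/-- The first `k` iterations of the protocol: the vectors `g¹, …, gᵏ` and the states of the
oracles. `γ k i x t` is the stochastic gradient available from worker `i` at iteration `k`. -/
def run {n d : ℕ} (v : Fin n → ℝ≥0 → ℝ≥0) (A : Algorithm n d)
    (γ : ℕ → Fin n → EuclideanSpace ℝ (Fin d) → ℝ≥0 → EuclideanSpace ℝ (Fin d)) :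
    (k : ℕ) → (Fin k → EuclideanSpace ℝ (Fin d)) × (Fin n → OracleState d)
  | 0 => (Fin.elim0, fun _ => idle d)
  | k + 1 =>
    let h := run v A γ k
    let q := A k h.1
    let o := oracle (v q.worker) (γ k q.worker) q.time q.point (h.2 q.worker) q.cancel
    (Fin.snoc h.1 o.2, Function.update h.2 q.worker o.1)

/-- The transcript `(g¹, …, gᵏ)`. -/
def transcript {n d : ℕ} (v : Fin n → ℝ≥0 → ℝ≥0) (A : Algorithm n d)
    (γ : ℕ → Fin n → EuclideanSpace ℝ (Fin d) → ℝ≥0 → EuclideanSpace ℝ (Fin d)) (k : ℕ) :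
    Fin k → EuclideanSpace ℝ (Fin d) :=
  (run v A γ k).1

/-- The point `xᵏ` of the protocol. -/
def iterate {n d : ℕ} (v : Fin n → ℝ≥0 → ℝ≥0) (A : Algorithm n d)
    (γ : ℕ → Fin n → EuclideanSpace ℝ (Fin d) → ℝ≥0 → EuclideanSpace ℝ (Fin d)) (k : ℕ) :
    EuclideanSpace ℝ (Fin d) :=
  (A k (transcript v A γ k)).point

/-- The time `tᵏ` of the protocol, with `t⁰ = 0`. -/
def iterTime {n d : ℕ} (v : Fin n → ℝ≥0 → ℝ≥0) (A : Algorithm n d)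
    (γ : ℕ → Fin n → EuclideanSpace ℝ (Fin d) → ℝ≥0 → EuclideanSpace ℝ (Fin d)) : ℕ → ℝ≥0
  | 0 => 0
  | k + 1 => (A k (transcript v A γ k)).time

/-! ### Objective functions -/

/-- `f = (1/n) ∑ᵢ fᵢ`. -/
def average {n d : ℕ} (f : Fin n → EuclideanSpace ℝ (Fin d) → ℝ) :
    EuclideanSpace ℝ (Fin d) → ℝ :=
  fun x => (n : ℝ)⁻¹ * ∑ i, f i x

/-- `F` is differentiable, `L`-smooth and bounded below by some `F⋆` with `F(0) - F⋆ ≤ Δ`. -/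
structure IsAdmissible {d : ℕ} (L Δ : ℝ) (F : EuclideanSpace ℝ (Fin d) → ℝ) : Prop where
  differentiable : Differentiable ℝ F
  smooth : ∀ x y, ‖gradient F x - gradient F y‖ ≤ L * ‖x - y‖
  gap : ∃ Fstar : ℝ, (∀ x, Fstar ≤ F x) ∧ F 0 - Fstar ≤ Δ

/-! ### Stochastic gradients

Local functions `f ω i` are random, the stochastic gradient mappings are `g i x ζ t`, and
iteration `k` uses the random element `ξ k`. The sampled functions may depend on the random
elements, so "expectation over the next random element" is the conditional expectation given
everything seen so far and the true local gradients at the point of the call. -/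

section Stochastic

variable {n d : ℕ} {Ω Ξ : Type}

/-- The realization of the stochastic gradients of all iterations for the outcome `ω`. -/
def realize (g : Fin n → EuclideanSpace ℝ (Fin d) → Ξ → ℝ≥0 → EuclideanSpace ℝ (Fin d))
    (ξ : ℕ → Ω → Ξ) (ω : Ω) :
    ℕ → Fin n → EuclideanSpace ℝ (Fin d) → ℝ≥0 → EuclideanSpace ℝ (Fin d) :=
  fun k i x t => g i x (ξ k ω) t

/-- The σ-algebra of the information before the call of iteration `k`: it is generated by
`g¹, …, gᵏ` and by the true local gradients `∇fⱼ(xˡ)`, `j ∈ [n]`, `l ≤ k`. -/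
@[reducible]
def pastInfo (v : Fin n → ℝ≥0 → ℝ≥0) (A : Algorithm n d)
    (f : Ω → Fin n → EuclideanSpace ℝ (Fin d) → ℝ)
    (g : Fin n → EuclideanSpace ℝ (Fin d) → Ξ → ℝ≥0 → EuclideanSpace ℝ (Fin d))
    (ξ : ℕ → Ω → Ξ) (k : ℕ) : MeasurableSpace Ω :=
  MeasurableSpace.comap (fun ω => transcript v A (realize g ξ ω) k) inferInstance ⊔
    ⨆ (l : Fin (k + 1)) (j : Fin n), MeasurableSpace.comap
      (fun ω => gradient (f ω j) (iterate v A (realize g ξ ω) l)) inferInstance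

/-- `pastInfo` together with the true local gradients `∇fⱼ(X)`, `j ∈ [n]`, at a random
point `X`. -/
@[reducible]
def callInfo (v : Fin n → ℝ≥0 → ℝ≥0) (A : Algorithm n d)
    (f : Ω → Fin n → EuclideanSpace ℝ (Fin d) → ℝ)
    (g : Fin n → EuclideanSpace ℝ (Fin d) → Ξ → ℝ≥0 → EuclideanSpace ℝ (Fin d))
    (ξ : ℕ → Ω → Ξ) (k : ℕ) (X : Ω → EuclideanSpace ℝ (Fin d)) : MeasurableSpace Ω :=
  pastInfo v A f g ξ k ⊔
    ⨆ j : Fin n, MeasurableSpace.comap (fun ω => gradient (f ω j) (X ω)) inferInstance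

/-- The stochastic gradients are unbiased with variance at most `σ²`: at every iteration `k`, for
every worker `i`, every point and every time (both may be fixed, or be chosen by arbitrary rules
`x`, `t` from the vectors received so far, as the oracle does with `s_x` and `tᵏ⁺¹`),
`E[g i x ξ t | info] = ∇fᵢ(x)` and `E[‖g i x ξ t - ∇fᵢ(x)‖² | info] ≤ σ²`. -/
def UnbiasedBoundedVariance [mΩ : MeasurableSpace Ω] (P : Measure Ω)
    (v : Fin n → ℝ≥0 → ℝ≥0) (A : Algorithm n d) (σ : ℝ)
    (f : Ω → Fin n → EuclideanSpace ℝ (Fin d) → ℝ)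
    (g : Fin n → EuclideanSpace ℝ (Fin d) → Ξ → ℝ≥0 → EuclideanSpace ℝ (Fin d))
    (ξ : ℕ → Ω → Ξ) : Prop :=
  ∀ (k : ℕ) (i : Fin n)
    (x : (Fin k → EuclideanSpace ℝ (Fin d)) → EuclideanSpace ℝ (Fin d))
    (t : (Fin k → EuclideanSpace ℝ (Fin d)) → ℝ≥0),
    let τ : Ω → (Fin k → EuclideanSpace ℝ (Fin d)) := fun ω => transcript v A (realize g ξ ω) k
    let X : Ω → EuclideanSpace ℝ (Fin d) := fun ω => x (τ ω)
    let G : Ω → EuclideanSpace ℝ (Fin d) := fun ω => g i (X ω) (ξ k ω) (t (τ ω))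
    let D : Ω → EuclideanSpace ℝ (Fin d) := fun ω => gradient (f ω i) (X ω)
    let m : MeasurableSpace Ω := callInfo v A f g ξ k X
    m ≤ mΩ ∧
    Integrable G P ∧
    P[G | m] =ᵐ[P] D ∧
    Integrable (fun ω => ‖G ω - D ω‖ ^ 2) P ∧
    P[fun ω => ‖G ω - D ω‖ ^ 2 | m] ≤ᵐ[P] fun _ => σ ^ 2

end Stochastic

end TimeOracle

end

noncomputable section

namespace TimeOracle

/-! The hard function is a chain. With `y_0 = 1` and `y_{c+1} = x_c / lam` it sums links `-gate
(y_j) * ramp (y_{j+1})` plus a penalty for negative `y_{j+1}`. Since `gate` and its derivative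
vanish at `0`, a gradient at a point supported on the first `m` coordinates can reveal only
coordinate `m` in addition. As long as the last coordinate vanishes, the gradient has norm at least
`2√ε` (`le_norm_chainGrad_one`). Hence it suffices that, with probability at least `1/2`, the
algorithm has not discovered all `d = 2K` coordinates before `lowerTime K`: the expectation is then
at least `4ε / 2 > ε`.

Time is cut into rounds at the values of `lowerTime`. On worker `i`, a link has weight `n * w i`,
where `w` is chosen for the round in which the link becomes active, that is, in which its first
variable is discovered. The weights of a round sum to one, so the average of the local functions is
always the same unweighted chain, although the local functions are random and adapted to the run. A
stochastic gradient shows the frontier coordinate only with probability `p i`, and then divides it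
by `p i`. The variance bound allows `p i = min 1 ((n * w i * C / σ)^2)` with `C = 8√ε`. Let `M i` be
the largest number of computations worker `i` can complete in the round, and take `w i` proportional
to `1 / M i`. The expected number of successes is then at most `(n * C / σ)^2 / ∑ 1 / M i`, and this
is at most `1/4` because the harmonic mean of the `M i` does not exceed the threshold that ends the
round (`exists_isProfile`).

Call a discovery early if it happens in the round in which the current link became active. The
expected number of early discoveries is at most `(2K + 1) / 4` (`integral_earlyCount_le`), while
every other discovery uses up a round (`progress_le`). Discovering everything before `lowerTime K`
would need `K + 1` early discoveries, and Markov's inequality bounds the probability of that by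
`1/2`.

The delicate point is that the local functions depend on activation rounds of the whole run, hence
on future coins. Locality hides this. The run coincides with a simulation that uses only the rounds
known so far (`run_eq_sim`). At points inside the discovered coordinates, the conditioning
information is a function of the past, so the coin is fresh; at all other points the gradient is
returned without noise (`unbiasedBoundedVariance`). -/

/-! ### Scalar building blocks of the chain function -/

/-- The gate `u₊² / (1 + u₊²)`, which vanishes for `u ≤ 0`. -/
def gate (u : ℝ) : ℝ := (max u 0) ^ 2 / (1 + (max u 0) ^ 2)

/-- The derivative of `gate`. -/
def gateDeriv (u : ℝ) : ℝ := 2 * max u 0 / (1 + (max u 0) ^ 2) ^ 2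

/-- A bounded increasing positive function. -/
def ramp (u : ℝ) : ℝ := Real.pi / 2 + Real.arctan u

/-- The derivative of `ramp`. -/
def rampDeriv (u : ℝ) : ℝ := 1 / (1 + u ^ 2)

lemma hasDerivAt_max_zero_sq (u : ℝ) :
    HasDerivAt (fun x : ℝ => (max x 0) ^ 2) (2 * max u 0) u := by
  rcases lt_trichotomy u 0 with h | h | h
  · rw [max_eq_right h.le, mul_zero]
    refine (hasDerivAt_const u (0 : ℝ)).congr_of_eventuallyEq ?_
    filter_upwards [gt_mem_nhds h] with x hx
    simp [max_eq_right (le_of_lt hx)]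
  · subst h
    simp only [max_self, mul_zero]
    rw [hasDerivAt_iff_isLittleO]
    simp only [max_self, sub_zero, smul_zero, ne_eq, OfNat.ofNat_ne_zero, not_false_eq_true,
      zero_pow]
    refine Asymptotics.IsBigO.trans_isLittleO (g := fun x : ℝ => x ^ 2) ?_ ?_
    · refine Asymptotics.isBigO_of_le _ fun x => ?_
      rw [Real.norm_of_nonneg (by positivity), Real.norm_of_nonneg (by positivity)]
      rcases le_total x 0 with hx | hx
      · rw [max_eq_right hx]; simpa using sq_nonneg x
      · rw [max_eq_left hx]
    · simpa using Asymptotics.isLittleO_pow_id (𝕜 := ℝ) (n := 2) (by norm_num)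
  · rw [max_eq_left h.le]
    have : HasDerivAt (fun x : ℝ => x ^ 2) (2 * u) u := by simpa using hasDerivAt_pow 2 u
    refine this.congr_of_eventuallyEq ?_
    filter_upwards [lt_mem_nhds h] with x hx
    simp [max_eq_left (le_of_lt hx)]

lemma hasDerivAt_gate (u : ℝ) : HasDerivAt gate (gateDeriv u) u := by
  have h := hasDerivAt_max_zero_sq u
  have h2 := h.div (h.const_add 1) (by positivity)
  have h3 : (2 * max u 0 * (1 + (max u 0) ^ 2) - (max u 0) ^ 2 * (2 * max u 0)) /
      (1 + (max u 0) ^ 2) ^ 2 = gateDeriv u := by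
    unfold gateDeriv
    congr 1
    ring
  exact h3 ▸ h2

lemma hasDerivAt_ramp (u : ℝ) : HasDerivAt ramp (rampDeriv u) u :=
  (Real.hasDerivAt_arctan u).const_add _

lemma gate_nonneg (u : ℝ) : 0 ≤ gate u := by unfold gate; positivity

lemma gate_le_one (u : ℝ) : gate u ≤ 1 := by
  unfold gate
  rw [div_le_one (by positivity)]
  linarith

lemma gate_zero : gate 0 = 0 := by simp [gate]

lemma half_le_gate {u : ℝ} (hu : 1 ≤ u) : 1 / 2 ≤ gate u := by
  unfold gate
  rw [max_eq_left (by linarith), div_le_div_iff₀ (by norm_num) (by positivity)]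
  nlinarith

lemma gateDeriv_nonneg (u : ℝ) : 0 ≤ gateDeriv u := by
  unfold gateDeriv; positivity

lemma gateDeriv_le_one (u : ℝ) : gateDeriv u ≤ 1 := by
  unfold gateDeriv
  rw [div_le_one (by positivity)]
  have := le_max_right u 0
  nlinarith [sq_nonneg (max u 0 - 1), sq_nonneg (max u 0)]

lemma gateDeriv_zero : gateDeriv 0 = 0 := by simp [gateDeriv]

lemma ramp_nonneg (u : ℝ) : 0 ≤ ramp u := by
  unfold ramp; linarith [Real.neg_pi_div_two_lt_arctan u]

lemma ramp_le_four (u : ℝ) : ramp u ≤ 4 := by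
  unfold ramp; linarith [Real.arctan_lt_pi_div_two u, Real.pi_le_four]

lemma rampDeriv_nonneg (u : ℝ) : 0 ≤ rampDeriv u := by unfold rampDeriv; positivity

lemma rampDeriv_le_one (u : ℝ) : rampDeriv u ≤ 1 := by
  unfold rampDeriv
  rw [div_le_one (by positivity)]
  nlinarith

lemma half_le_rampDeriv {u : ℝ} (hu : |u| ≤ 1) : 1 / 2 ≤ rampDeriv u := by
  unfold rampDeriv
  have : u ^ 2 ≤ 1 := by rw [← sq_abs]; nlinarith [abs_nonneg u]
  rw [div_le_div_iff₀ (by norm_num) (by positivity)]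
  linarith

lemma abs_sub_le_of_hasDerivAt {f f' : ℝ → ℝ} {C : ℝ}
    (hf : ∀ u, HasDerivAt f (f' u) u) (hC : ∀ u, |f' u| ≤ C) (u w : ℝ) :
    |f u - f w| ≤ C * |u - w| := by
  have := Convex.norm_image_sub_le_of_norm_hasDerivWithin_le (s := Set.univ)
    (fun x _ => (hf x).hasDerivWithinAt) (fun x _ => by simpa using hC x) convex_univ
    (Set.mem_univ w) (Set.mem_univ u)
  simpa using this

lemma abs_max_zero_sub_le (u w : ℝ) : |max u 0 - max w 0| ≤ |u - w| := by
  simpa using abs_max_sub_max_le_abs u w 0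

lemma abs_gate_sub_le (u w : ℝ) : |gate u - gate w| ≤ |u - w| := by
  simpa using abs_sub_le_of_hasDerivAt hasDerivAt_gate (C := 1)
    (fun u => by rw [abs_of_nonneg (gateDeriv_nonneg u)]; exact gateDeriv_le_one u) u w

lemma abs_ramp_sub_le (u w : ℝ) : |ramp u - ramp w| ≤ |u - w| := by
  simpa using abs_sub_le_of_hasDerivAt hasDerivAt_ramp (C := 1)
    (fun u => by rw [abs_of_nonneg (rampDeriv_nonneg u)]; exact rampDeriv_le_one u) u w

lemma abs_rampDeriv_sub_le (u w : ℝ) : |rampDeriv u - rampDeriv w| ≤ |u - w| := by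
  have h : rampDeriv u - rampDeriv w = (w - u) * ((u + w) / ((1 + u ^ 2) * (1 + w ^ 2))) := by
    unfold rampDeriv; field_simp; ring
  rw [h, abs_mul, abs_sub_comm w u]
  refine mul_le_of_le_one_right (abs_nonneg _) ?_
  rw [abs_div, abs_of_pos (a := (1 + u ^ 2) * (1 + w ^ 2)) (by positivity),
    div_le_one (by positivity), abs_le]
  constructor <;> nlinarith [sq_nonneg (u - 1), sq_nonneg (w - 1), sq_nonneg (u + 1),
    sq_nonneg (w + 1), mul_nonneg (sq_nonneg u) (sq_nonneg w)]

/-- `gateDeriv` has a kink at `0`, so the derivative bound is applied to the smooth function `2x /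
(1 + x^2)^2`, composed with the 1-Lipschitz map `max · 0`. -/
lemma abs_gateDeriv_sub_le (u w : ℝ) : |gateDeriv u - gateDeriv w| ≤ 2 * |u - w| := by
  have key : ∀ x : ℝ, HasDerivAt (fun x : ℝ => 2 * x / (1 + x ^ 2) ^ 2)
      (2 * (1 - 3 * x ^ 2) / (1 + x ^ 2) ^ 3) x := by
    intro x
    have h1 : HasDerivAt (fun x : ℝ => 2 * x) 2 x := by simpa using (hasDerivAt_id x).const_mul 2
    have h2 : HasDerivAt (fun x : ℝ => 1 + x ^ 2) (2 * x) x := by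
      simpa using (hasDerivAt_pow 2 x).const_add 1
    have h3 := h1.div (h2.pow 2) (pow_ne_zero 2 (by positivity))
    refine h3.congr_deriv ?_
    simp only [Pi.pow_apply]
    field_simp
    ring
  have hb : ∀ x : ℝ, |2 * (1 - 3 * x ^ 2) / (1 + x ^ 2) ^ 3| ≤ 2 := by
    intro x
    have hx := sq_nonneg x
    rw [abs_div, abs_of_pos (a := (1 + x ^ 2) ^ 3) (by positivity), div_le_iff₀ (by positivity),
      abs_le]
    constructor <;> nlinarith [mul_nonneg hx hx, mul_nonneg (mul_nonneg hx hx) hx]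
  refine (abs_sub_le_of_hasDerivAt key hb (max u 0) (max w 0)).trans ?_
  linarith [abs_max_zero_sub_le u w]

lemma abs_mul_sub_mul_le {a b c d A B : ℝ} (ha : |a| ≤ A) (hd : |d| ≤ B) :
    |a * b - c * d| ≤ A * |b - d| + B * |a - c| := by
  have h : a * b - c * d = a * (b - d) + d * (a - c) := by ring
  rw [h]
  refine (abs_add_le _ _).trans ?_
  rw [abs_mul, abs_mul]
  gcongr

/-- The partial derivative of the unweighted chain with respect to its middle variable. -/
def chainPartial (r u w : ℝ) : ℝ :=
  -(gate r * rampDeriv u) - max (-u) 0 - gateDeriv u * ramp w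

/-- The constant is the coefficient of `|u - u'|`: `1` from `rampDeriv`, `1` from the penalty, and
`4 * 2 = 8` from `gateDeriv` times the bound on `ramp`. -/
lemma abs_chainPartial_sub_le (r u w r' u' w' : ℝ) :
    |chainPartial r u w - chainPartial r' u' w'| ≤
      10 * (|r - r'| + |u - u'| + |w - w'|) := by
  have h1 : |gate r * rampDeriv u - gate r' * rampDeriv u'| ≤ 1 * |u - u'| + 1 * |r - r'| := by
    refine (abs_mul_sub_mul_le (A := 1) (B := 1) ?_ ?_).trans ?_
    · rw [abs_of_nonneg (gate_nonneg r)]; exact gate_le_one r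
    · rw [abs_of_nonneg (rampDeriv_nonneg u')]; exact rampDeriv_le_one u'
    · linarith [abs_rampDeriv_sub_le u u', abs_gate_sub_le r r']
  have h2 : |gateDeriv u * ramp w - gateDeriv u' * ramp w'| ≤
      1 * |w - w'| + 4 * (2 * |u - u'|) := by
    refine (abs_mul_sub_mul_le (A := 1) (B := 4) ?_ ?_).trans ?_
    · rw [abs_of_nonneg (gateDeriv_nonneg u)]; exact gateDeriv_le_one u
    · rw [abs_of_nonneg (ramp_nonneg w')]; exact ramp_le_four w'
    · linarith [abs_ramp_sub_le w w', abs_gateDeriv_sub_le u u']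
  have h3 : |max (-u) 0 - max (-u') 0| ≤ |u - u'| := by
    refine (abs_max_zero_sub_le _ _).trans_eq ?_
    rw [← abs_neg]; congr 1; ring
  have h : chainPartial r u w - chainPartial r' u' w' =
      -(gate r * rampDeriv u - gate r' * rampDeriv u') +
      (-(max (-u) 0 - max (-u') 0) +
        -(gateDeriv u * ramp w - gateDeriv u' * ramp w')) := by
    unfold chainPartial; ring
  rw [h]
  refine (abs_add_le _ _).trans ((add_le_add le_rfl (abs_add_le _ _)).trans ?_)
  rw [abs_neg, abs_neg, abs_neg]
  linarith [abs_nonneg (r - r'), abs_nonneg (u - u'), abs_nonneg (w - w')]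

/-- All three terms push `u` upwards. For `u ≤ -1` the penalty alone suffices; for `|u| ≤ 1` the
product of `gate` and `rampDeriv` is at least `1/2 * 1/2`. -/
lemma quarter_le_neg_chainPartial {r u : ℝ} (w : ℝ) (hr : 1 ≤ r) (hu : u ≤ 1) :
    1 / 4 ≤ -chainPartial r u w := by
  have h2 : 0 ≤ gateDeriv u * ramp w := mul_nonneg (gateDeriv_nonneg u) (ramp_nonneg w)
  have h1 : 0 ≤ gate r * rampDeriv u := mul_nonneg (gate_nonneg r) (rampDeriv_nonneg u)
  unfold chainPartial
  rcases le_total u (-1) with h | h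
  · have := le_max_left (-u) 0
    linarith
  · have h3 := le_max_right (-u) 0
    have h4 := mul_le_mul (half_le_gate hr) (half_le_rampDeriv (abs_le.2 ⟨h, hu⟩)) (by norm_num)
      (gate_nonneg r)
    linarith

/-! ### The weighted chain function -/

section Chain

variable {d : ℕ}

/-- The variables of the chain: the constant `1`, then the rescaled coordinates, then `0`. -/
def chainVar (lam : ℝ) (x : EuclideanSpace ℝ (Fin d)) : ℕ → ℝ
  | 0 => 1
  | j + 1 => if h : j < d then lam⁻¹ * x ⟨j, h⟩ else 0

/-- One link of the chain. -/
def link (r u : ℝ) : ℝ := -(gate r * ramp u) + (max (-u) 0) ^ 2 / 2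

/-- The chain function with weights `W`. -/
def chainFun (a lam : ℝ) (W : ℕ → ℝ) (x : EuclideanSpace ℝ (Fin d)) : ℝ :=
  a * ∑ j ∈ Finset.range (d + 1), W j * link (chainVar lam x j) (chainVar lam x (j + 1))

/-- The gradient of the chain function. -/
def chainGrad (a lam : ℝ) (W : ℕ → ℝ) (x : EuclideanSpace ℝ (Fin d)) :
    EuclideanSpace ℝ (Fin d) :=
  WithLp.toLp 2 fun c => a * lam⁻¹ *
    (W c * (-(gate (chainVar lam x c) * rampDeriv (chainVar lam x (c + 1)))
        - max (-chainVar lam x (c + 1)) 0)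
      - W (c + 1) * (gateDeriv (chainVar lam x (c + 1)) * ramp (chainVar lam x (c + 2))))

/-- The derivative of `chainVar`. -/
def chainVarDeriv (d : ℕ) (lam : ℝ) : ℕ → EuclideanSpace ℝ (Fin d) →L[ℝ] ℝ
  | 0 => 0
  | j + 1 => if h : j < d then lam⁻¹ • EuclideanSpace.proj (𝕜 := ℝ) ⟨j, h⟩ else 0

lemma hasFDerivAt_chainVar (lam : ℝ) (j : ℕ) (x : EuclideanSpace ℝ (Fin d)) :
    HasFDerivAt (fun x => chainVar lam x j) (chainVarDeriv d lam j) x := by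
  cases j with
  | zero => exact hasFDerivAt_const _ _
  | succ j =>
    by_cases h : j < d
    · simp only [chainVar, chainVarDeriv, h, dite_true]
      exact ((EuclideanSpace.proj (𝕜 := ℝ) (⟨j, h⟩ : Fin d)).hasFDerivAt).const_mul lam⁻¹
    · simp only [chainVar, chainVarDeriv, h, dite_false]
      exact hasFDerivAt_const _ _

lemma hasFDerivAt_link (lam : ℝ) (j : ℕ) (x : EuclideanSpace ℝ (Fin d)) :
    HasFDerivAt (fun x => link (chainVar lam x j) (chainVar lam x (j + 1)))
      ((-(gateDeriv (chainVar lam x j) * ramp (chainVar lam x (j + 1)))) • chainVarDeriv d lam j +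
        (-(gate (chainVar lam x j) * rampDeriv (chainVar lam x (j + 1)))
          - max (-chainVar lam x (j + 1)) 0) • chainVarDeriv d lam (j + 1)) x := by
  have h1 := hasFDerivAt_chainVar lam j x
  have h2 := hasFDerivAt_chainVar lam (j + 1) x
  have hg := (hasDerivAt_gate _).comp_hasFDerivAt x h1
  have hr := (hasDerivAt_ramp _).comp_hasFDerivAt x h2
  have hq := (hasDerivAt_max_zero_sq (-chainVar lam x (j + 1))).comp_hasFDerivAt x h2.neg
  have hs := (hg.mul hr).neg.add (hq.mul_const (2 : ℝ)⁻¹)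
  refine (hs.congr_fderiv ?_).congr_of_eventuallyEq (Filter.Eventually.of_forall fun y => ?_)
  · ext y
    simp
    ring
  · simp [link, div_eq_mul_inv]

lemma hasGradientAt_chainFun (a lam : ℝ) (W : ℕ → ℝ) (x : EuclideanSpace ℝ (Fin d)) :
    HasGradientAt (chainFun a lam W) (chainGrad a lam W x) x := by
  rw [hasGradientAt_iff_hasFDerivAt]
  have h := (HasFDerivAt.fun_sum (u := Finset.range (d + 1))
    fun j _ => (hasFDerivAt_link lam j x).const_mul (W j)).const_mul a
  refine h.congr_fderiv ?_
  ext y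
  have hlast : chainVarDeriv d lam (d + 1) = 0 := by simp [chainVarDeriv]
  have hc : ∀ c : Fin d, chainVarDeriv d lam (c + 1) y = lam⁻¹ * y c := by
    intro c; simp [chainVarDeriv]
  simp only [InnerProductSpace.toDual_apply_apply, PiLp.inner_apply, chainGrad,
    smul_apply, sum_apply, add_apply,
    smul_eq_mul, mul_add, Finset.sum_add_distrib]
  -- The first variable of link `0` and the second variable of link `d` are constants. Dropping
  -- these two terms leaves both sums indexed by the `d` coordinates.
  rw [Finset.sum_range_succ', Finset.sum_range_succ (n := d), hlast]
  simp only [chainVarDeriv, zero_apply, mul_zero, add_zero]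
  rw [Finset.sum_range, Finset.sum_range, ← mul_add, ← Finset.sum_add_distrib, Finset.mul_sum]
  refine Finset.sum_congr rfl fun c _ => ?_
  have := hc c
  simp only [chainVarDeriv] at this
  rw [this]
  simp
  ring

lemma gradient_chainFun (a lam : ℝ) (W : ℕ → ℝ) (x : EuclideanSpace ℝ (Fin d)) :
    gradient (chainFun a lam W) x = chainGrad a lam W x :=
  (hasGradientAt_chainFun a lam W x).gradient

lemma differentiable_chainFun (a lam : ℝ) (W : ℕ → ℝ) :
    Differentiable ℝ (chainFun (d := d) a lam W) := fun x =>
  (hasGradientAt_chainFun a lam W x).differentiableAt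

lemma chainGrad_one_apply (a lam : ℝ) (x : EuclideanSpace ℝ (Fin d)) (c : Fin d) :
    chainGrad a lam (fun _ => 1) x c = a * lam⁻¹ *
      chainPartial (chainVar lam x c) (chainVar lam x (c + 1)) (chainVar lam x (c + 2)) := by
  simp [chainGrad, chainPartial]

/-- The bound holds for every `N`, so that it controls the three shifted sums in the Lipschitz
estimate of the gradient. -/
lemma sum_sq_chainVar_sub {lam : ℝ} (x y : EuclideanSpace ℝ (Fin d)) (N : ℕ) :
    ∑ j ∈ Finset.range N, (chainVar lam x j - chainVar lam y j) ^ 2 ≤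
      (lam⁻¹ * ‖x - y‖) ^ 2 := by
  have hmono : ∑ j ∈ Finset.range N, (chainVar lam x j - chainVar lam y j) ^ 2 ≤
      ∑ j ∈ Finset.range (N + d + 1), (chainVar lam x j - chainVar lam y j) ^ 2 :=
    Finset.sum_le_sum_of_subset_of_nonneg
      (Finset.range_subset_range.2 (by omega)) fun _ _ _ => sq_nonneg _
  refine hmono.trans_eq ?_
  rw [Finset.sum_range_succ', add_comm N d, Finset.sum_range_add, Finset.sum_range]
  have : ∀ k, chainVar lam x (d + k + 1) - chainVar lam y (d + k + 1) = 0 := by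
    intro k; simp [chainVar]
  simp only [this]
  rw [mul_pow, EuclideanSpace.norm_sq_eq, Finset.mul_sum]
  simp [chainVar, ← mul_sub, mul_pow]

/-- Each partial derivative sees three neighbouring variables and is 10-Lipschitz in their `ℓ¹`
distance. Cauchy-Schwarz gives `300` times a sum of three squares, and each variable is counted at
most three times: `900 = 30^2`. -/
lemma norm_chainGrad_sub_le {a lam : ℝ} (ha : 0 ≤ a) (hlam : 0 < lam)
    (x y : EuclideanSpace ℝ (Fin d)) :
    ‖chainGrad a lam (fun _ => 1) x - chainGrad a lam (fun _ => 1) y‖ ≤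
      30 * a * lam⁻¹ ^ 2 * ‖x - y‖ := by
  have hli : 0 < lam⁻¹ := inv_pos.2 hlam
  refine abs_le_of_sq_le_sq' ?_ (by positivity) |>.2
  rw [EuclideanSpace.norm_sq_eq]
  set e : ℕ → ℝ := fun j => chainVar lam x j - chainVar lam y j with he
  have hterm : ∀ c : Fin d,
      ‖(chainGrad a lam (fun _ => 1) x - chainGrad a lam (fun _ => 1) y) c‖ ^ 2 ≤
        (a * lam⁻¹) ^ 2 * 300 * (e c ^ 2 + e (c + 1) ^ 2 + e (c + 2) ^ 2) := by
    intro c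
    rw [PiLp.sub_apply, chainGrad_one_apply, chainGrad_one_apply, ← mul_sub, Real.norm_eq_abs,
      abs_mul, mul_pow, sq_abs]
    have h := abs_chainPartial_sub_le (chainVar lam x c) (chainVar lam x (c + 1))
      (chainVar lam x (c + 2)) (chainVar lam y c) (chainVar lam y (c + 1))
      (chainVar lam y (c + 2))
    rw [mul_assoc]
    refine mul_le_mul_of_nonneg_left ?_ (by positivity)
    refine (pow_le_pow_left₀ (abs_nonneg _) h 2).trans ?_
    rw [← sq_abs (e c), ← sq_abs (e (c + 1)), ← sq_abs (e (c + 2))]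
    simp only [he]
    nlinarith [sq_nonneg (|e c| - |e (c + 1)|), sq_nonneg (|e c| - |e (c + 2)|),
      sq_nonneg (|e (c + 1)| - |e (c + 2)|)]
  refine (Finset.sum_le_sum fun c _ => hterm c).trans ?_
  rw [← Finset.mul_sum, Finset.sum_add_distrib, Finset.sum_add_distrib,
    ← Finset.sum_range (fun j => e j ^ 2), ← Finset.sum_range (fun j => e (j + 1) ^ 2),
    ← Finset.sum_range (fun j => e (j + 2) ^ 2)]
  have hN := fun N => sum_sq_chainVar_sub (lam := lam) x y N
  have h0 := hN d
  have h1 := hN (d + 1)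
  have h2 := hN (d + 2)
  rw [Finset.sum_range_succ'] at h1
  rw [Finset.sum_range_succ', Finset.sum_range_succ'] at h2
  have hs : ∑ j ∈ Finset.range d, e j ^ 2 + ∑ j ∈ Finset.range d, e (j + 1) ^ 2 +
      ∑ j ∈ Finset.range d, e (j + 2) ^ 2 ≤ 3 * (lam⁻¹ * ‖x - y‖) ^ 2 := by
    have e0 := sq_nonneg (e 0)
    have e1 := sq_nonneg (e (0 + 1))
    simp only [he] at e0 e1 ⊢
    linarith
  calc _ ≤ (a * lam⁻¹) ^ 2 * 300 * (3 * (lam⁻¹ * ‖x - y‖) ^ 2) :=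
        mul_le_mul_of_nonneg_left hs (by positivity)
    _ = _ := by ring

lemma neg_le_chainFun_one {a lam : ℝ} (ha : 0 ≤ a) (x : EuclideanSpace ℝ (Fin d)) :
    -(a * (4 * (d + 1))) ≤ chainFun a lam (fun _ => 1) x := by
  unfold chainFun
  rw [← mul_neg]
  refine mul_le_mul_of_nonneg_left ?_ ha
  have : ∀ j ∈ Finset.range (d + 1),
      (-4 : ℝ) ≤ 1 * link (chainVar lam x j) (chainVar lam x (j + 1)) := by
    intro j _
    have := mul_le_mul (gate_le_one (chainVar lam x j)) (ramp_le_four (chainVar lam x (j + 1)))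
      (ramp_nonneg _) zero_le_one
    unfold link
    nlinarith [sq_nonneg (max (-chainVar lam x (j + 1)) 0)]
  have h := Finset.card_nsmul_le_sum _ _ _ this
  simp only [Finset.card_range, nsmul_eq_mul] at h
  push_cast at h
  linarith

lemma chainFun_one_zero_le {a lam : ℝ} (ha : 0 ≤ a) :
    chainFun a lam (fun _ => 1) (0 : EuclideanSpace ℝ (Fin d)) ≤ 0 := by
  unfold chainFun
  refine mul_nonpos_of_nonneg_of_nonpos ha (Finset.sum_nonpos fun j _ => ?_)
  have h : chainVar lam (0 : EuclideanSpace ℝ (Fin d)) (j + 1) = 0 := by simp [chainVar]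
  rw [h, one_mul, link]
  have := mul_nonneg (gate_nonneg (chainVar lam (0 : EuclideanSpace ℝ (Fin d)) j)) (ramp_nonneg 0)
  simpa using this

lemma isAdmissible_chainFun {a lam L Δ : ℝ} (ha : 0 ≤ a) (hlam : 0 < lam)
    (hL : 30 * a * lam⁻¹ ^ 2 ≤ L) (hΔ : a * (4 * (d + 1)) ≤ Δ) :
    IsAdmissible L Δ (chainFun (d := d) a lam fun _ => 1) where
  differentiable := differentiable_chainFun _ _ _
  smooth x y := by
    rw [gradient_chainFun, gradient_chainFun]
    exact (norm_chainGrad_sub_le ha hlam x y).trans (by gcongr)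
  gap := ⟨-(a * (4 * (d + 1))), neg_le_chainFun_one ha, by
    linarith [chainFun_one_zero_le (d := d) (lam := lam) ha]⟩

/-- As long as the last coordinate vanishes, the gradient of the chain is large. -/
lemma le_norm_chainGrad_one {a lam : ℝ} (ha : 0 ≤ a) (hlam : 0 < lam)
    (x : EuclideanSpace ℝ (Fin d)) (hx : chainVar lam x d < 1) :
    a * lam⁻¹ / 4 ≤ ‖chainGrad a lam (fun _ => 1) x‖ := by
  classical
  have hex : ∃ j, chainVar lam x j < 1 := ⟨d, hx⟩
  -- The first variable below `1` is not `y_0 = 1`, so its predecessor is at least `1`, and the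
  -- partial derivative in this variable is large.
  set j := Nat.find hex with hj
  have hj1 : chainVar lam x j < 1 := Nat.find_spec hex
  have hjd : j ≤ d := Nat.find_min' hex hx
  obtain ⟨c, hc⟩ : ∃ c, j = c + 1 := by
    refine Nat.exists_eq_succ_of_ne_zero fun h0 => ?_
    rw [h0] at hj1
    simp [chainVar] at hj1
  have hprev : 1 ≤ chainVar lam x c := not_lt.1 (Nat.find_min hex (by omega))
  rw [hc] at hj1
  have hcd : c < d := by omega
  have h := quarter_le_neg_chainPartial (chainVar lam x (c + 2)) hprev hj1.le
  have hn := PiLp.norm_apply_le (chainGrad a lam (fun _ => 1) x) ⟨c, hcd⟩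
  refine le_trans ?_ hn
  rw [chainGrad_one_apply, Real.norm_eq_abs, abs_mul, abs_of_nonneg (by positivity), div_eq_mul_inv]
  refine mul_le_mul_of_nonneg_left ?_ (by positivity)
  refine le_trans ?_ (neg_le_abs _)
  simpa using h

/-! ### Locality of the chain -/

/-- All coordinates of `x` from the `m`-th on vanish. -/
def SuppBelow (m : ℕ) (x : EuclideanSpace ℝ (Fin d)) : Prop := ∀ c : Fin d, m ≤ c → x c = 0

lemma SuppBelow.mono {m m' : ℕ} (h : m ≤ m') {x : EuclideanSpace ℝ (Fin d)}
    (hx : SuppBelow m x) : SuppBelow m' x := fun c hc => hx c (h.trans hc)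

lemma suppBelow_zero (m : ℕ) : SuppBelow m (0 : EuclideanSpace ℝ (Fin d)) := fun _ _ => rfl

lemma SuppBelow.chainVar_eq_zero {lam : ℝ} {m j : ℕ} {x : EuclideanSpace ℝ (Fin d)}
    (hx : SuppBelow m x) (hj : m < j) : chainVar lam x j = 0 := by
  cases j with
  | zero => omega
  | succ j =>
    simp only [chainVar]
    split_ifs with h
    · rw [hx ⟨j, h⟩ (by simpa using Nat.lt_succ_iff.1 hj), mul_zero]
    · rfl

/-- Links after `m` have first variable `0`, where both `gate` and its derivative vanish, and second
variable `0`, where the penalty is flat; their weights cannot matter. -/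
lemma chainGrad_congr {a lam : ℝ} {m : ℕ} {W W' : ℕ → ℝ} {x : EuclideanSpace ℝ (Fin d)}
    (hx : SuppBelow m x) (hW : ∀ j ≤ m, W j = W' j) :
    chainGrad a lam W x = chainGrad a lam W' x := by
  ext c
  simp only [chainGrad]
  rcases lt_trichotomy (c : ℕ) m with h | h | h
  · rw [hW c h.le, hW (c + 1) h]
  · rw [hx.chainVar_eq_zero (j := c + 1) (by omega), hW c h.le, gateDeriv_zero]
    ring
  · rw [hx.chainVar_eq_zero (j := c + 1) (by omega), hx.chainVar_eq_zero (j := c) h,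
      gateDeriv_zero, gate_zero]
    simp

lemma chainGrad_apply_of_lt {a lam : ℝ} {m : ℕ} {W : ℕ → ℝ} {x : EuclideanSpace ℝ (Fin d)}
    (hx : SuppBelow m x) {c : Fin d} (hc : m < c) : chainGrad a lam W x c = 0 := by
  simp only [chainGrad]
  rw [hx.chainVar_eq_zero (j := c + 1) (by omega), hx.chainVar_eq_zero (j := c) hc,
      gateDeriv_zero, gate_zero]
  simp

lemma chainGrad_apply_frontier {a lam : ℝ} {W : ℕ → ℝ} {x : EuclideanSpace ℝ (Fin d)}
    {c : Fin d} (hx : SuppBelow c x) :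
    chainGrad a lam W x c = -(a * lam⁻¹ * (W c * gate (chainVar lam x c))) := by
  simp only [chainGrad]
  rw [hx.chainVar_eq_zero (j := c + 1) (by omega), gateDeriv_zero]
  simp [rampDeriv]

end Chain

/-! ### Work and the sequence of times -/

lemma V_mono (v : ℝ≥0 → ℝ≥0) {s t : ℝ≥0∞} (h : s ≤ t) : V v s ≤ V v t :=
  lintegral_mono_set fun _ hτ => ⟨hτ.1, hτ.2.trans h⟩

/-- Absolute continuity of the integral: no worker completes a computation arbitrarily fast after
time `0`. -/
lemma exists_V_lt_one {v : ℝ≥0 → ℝ≥0} (hv : IsComputationPower v) :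
    ∃ η : ℝ≥0∞, 0 < η ∧ ∀ t < η, V v t < 1 := by
  set A : Set ℝ := {τ : ℝ | 0 ≤ τ ∧ ENNReal.ofReal τ ≤ ((1 : ℝ≥0) : ℝ≥0∞)} with hA
  obtain ⟨δ, hδ, h⟩ := exists_pos_setLIntegral_lt_of_measure_lt
    (μ := volume.restrict A) (f := fun τ => (v τ.toNNReal : ℝ≥0∞)) (hv.finite 1).ne
    (ε := 1) one_ne_zero
  refine ⟨min δ 1, lt_min hδ one_pos, fun t ht => ?_⟩
  set B : Set ℝ := {τ : ℝ | 0 ≤ τ ∧ ENNReal.ofReal τ ≤ t} with hB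
  have htop : t ≠ ⊤ := ((ht.trans_le (min_le_right _ _)).trans_le le_top).ne
  have hBI : B ⊆ Set.Icc 0 t.toReal := fun τ hτ =>
    ⟨hτ.1, (ENNReal.ofReal_le_iff_le_toReal htop).1 hτ.2⟩
  have hBA : B ⊆ A := fun τ hτ =>
    ⟨hτ.1, by simpa using hτ.2.trans (ht.le.trans (min_le_right _ _))⟩
  have hvol : volume.restrict A B < δ := by
    refine (Measure.restrict_apply_le _ _).trans_lt ((measure_mono hBI).trans_lt ?_)
    rw [Real.volume_Icc, sub_zero, ENNReal.ofReal_toReal htop]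
    exact ht.trans_le (min_le_left _ _)
  have := h B hvol
  rwa [Measure.restrict_restrict_of_subset hBA] at this

lemma harmonicWork_eq_zero {n : ℕ} {v : Fin n → ℝ≥0 → ℝ≥0} {c₃ : ℝ} {s t : ℝ≥0∞} (i : Fin n)
    (h : ⌊c₃ * (V (v i) t - V (v i) s).toReal⌋₊ = 0) : harmonicWork v c₃ s t = 0 := by
  unfold harmonicWork
  rw [ENNReal.inv_eq_zero, ENNReal.mul_eq_top]
  left
  refine ⟨by simp, ?_⟩
  rw [ENNReal.sum_eq_top]
  exact ⟨i, Finset.mem_univ _, by simp [h]⟩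

/-- A worker with no completed computation contributes `0⁻¹ = ∞` and makes the harmonic mean `0`,
which is below the threshold because of the `max` with `1`. -/
lemma one_le_V_sub {n : ℕ} {v : Fin n → ℝ≥0 → ℝ≥0} {B : ℝ} {s t : ℝ≥0∞}
    (h : ENNReal.ofReal (max B 1) ≤ harmonicWork v 1 s t) (i : Fin n) :
    1 ≤ V (v i) t - V (v i) s := by
  by_contra hlt
  rw [harmonicWork_eq_zero i] at h
  · have : (1 : ℝ) ≤ max B 1 := le_max_right _ _
    rw [nonpos_iff_eq_zero, ENNReal.ofReal_eq_zero] at h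
    linarith
  · rw [one_mul, Nat.floor_eq_zero]
    exact ENNReal.toReal_lt_of_lt_ofReal (by simpa using hlt)

section LowerTime

variable {n : ℕ} {v : Fin n → ℝ≥0 → ℝ≥0} {c₂ σ ε : ℝ}

lemma lowerTime_le_succ (hn : 0 < n) (r : ℕ) :
    lowerTime v c₂ 1 σ ε r ≤ lowerTime v c₂ 1 σ ε (r + 1) := by
  rw [lowerTime]
  refine le_sInf fun t ht => ?_
  by_contra hlt
  have h := one_le_V_sub ht.2 ⟨0, hn⟩
  rw [tsub_eq_zero_of_le (V_mono _ (not_le.1 hlt).le)] at h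
  exact absurd h (by simp)

lemma lowerTime_mono (hn : 0 < n) : Monotone (lowerTime v c₂ 1 σ ε) :=
  monotone_nat_of_le_succ (lowerTime_le_succ hn)

/-- Positivity makes half of a finite `lowerTime` strictly smaller than `lowerTime` itself, so the
closed time constraint of the theorem becomes the strict one of the counting argument. -/
lemma lowerTime_pos (hn : 0 < n) (hv : ∀ i, IsComputationPower (v i)) {r : ℕ} (hr : 0 < r) :
    0 < lowerTime v c₂ 1 σ ε r := by
  obtain ⟨η, hη, h⟩ := exists_V_lt_one (hv ⟨0, hn⟩)
  refine hη.trans_le (le_trans ?_ (lowerTime_mono hn (Nat.succ_le_of_lt hr)))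
  rw [Nat.succ_eq_add_one, zero_add, lowerTime]
  refine le_sInf fun t ht => ?_
  by_contra hlt
  have h1 := one_le_V_sub ht.2 ⟨0, hn⟩
  exact absurd (h1.trans tsub_le_self) (not_le.2 (h t (not_le.1 hlt)))

lemma harmonicWork_lt_of_lt {r : ℕ} {t : ℝ≥0}
    (ht : (t : ℝ≥0∞) < lowerTime v c₂ 1 σ ε (r + 1)) :
    harmonicWork v 1 (lowerTime v c₂ 1 σ ε r) t <
      ENNReal.ofReal (max (c₂ * (σ ^ 2 / (n * ε))) 1) := by
  by_contra hle
  rw [lowerTime] at ht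
  refine absurd (sInf_le ?_) (not_le.2 ht)
  exact ⟨ENNReal.coe_ne_top, not_lt.1 hle⟩

end LowerTime

/-! ### Weights and success probabilities for one round -/

/-- Weights `w` of the workers and success probabilities `p` such that the rescaled coin flips
have variance at most `σ²`, and such that the expected number of successes is at most `1/4` if
worker `i` flips at most `cnt i` coins for counts satisfying `feasible`. -/
structure IsProfile {n : ℕ} (feasible : (Fin n → ℕ) → Prop) (C σ : ℝ) (w p : Fin n → ℝ) :
    Prop where
  weight_nonneg : ∀ i, 0 ≤ w i
  sum_weight : ∑ i, w i = 1
  prob_nonneg : ∀ i, 0 ≤ p i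
  prob_le_one : ∀ i, p i ≤ 1
  weight_eq_zero : ∀ i, p i = 0 → w i = 0
  variance : ∀ i, (n * w i) ^ 2 * C ^ 2 * (1 - p i) ≤ p i * σ ^ 2
  sum_prob_le : ∀ cnt, feasible cnt → ∑ i, p i * cnt i ≤ 1 / 4

/-- A worker that completes nothing during the round can carry the whole weight. Its coin succeeds
surely, so there is no noise, yet it is never flipped. -/
lemma isProfile_single {n : ℕ} {feasible : (Fin n → ℕ) → Prop} (C σ : ℝ) (i₀ : Fin n)
    (h : ∀ cnt, feasible cnt → cnt i₀ = 0) :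
    IsProfile feasible C σ (Pi.single i₀ 1) (Pi.single i₀ 1) where
  weight_nonneg i := by by_cases h : i = i₀ <;> simp [h]
  sum_weight := by simp
  prob_nonneg i := by by_cases h : i = i₀ <;> simp [h]
  prob_le_one i := by by_cases h : i = i₀ <;> simp [h]
  weight_eq_zero i hi := hi
  variance i := by
    by_cases h : i = i₀
    · subst h; simpa using sq_nonneg σ
    · simp [h]
  sum_prob_le cnt hc := by
    refine (Finset.sum_nonpos fun i _ => ?_).trans (by norm_num)
    by_cases hi : i = i₀
    · subst hi; simp [h cnt hc]
    · simp [hi]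

/-- Weights proportional to `1 / M i` balance the workers: each one contributes at most `(n * C /
σ)^2 * h i / H^2` to the expected number of successes, and the sum is `(n * C / σ)^2 / H`. -/
lemma isProfile_harmonic {n : ℕ} {feasible : (Fin n → ℕ) → Prop} {C σ : ℝ} (hσ : 0 < σ)
    (M : Fin n → ℝ≥0∞)
    (hcnt : ∀ cnt, feasible cnt → ∀ i, (cnt i : ℝ≥0∞) ≤ M i)
    (hC : 0 < C) (hn : 0 < n) (hH : 4 * (n * C / σ) ^ 2 ≤ ∑ i, (M i)⁻¹.toReal) :
    ∃ w p, IsProfile feasible C σ w p := by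
  set h : Fin n → ℝ := fun i => (M i)⁻¹.toReal with hh
  set H := ∑ i, h i with hHdef
  have hn' : (0 : ℝ) < n := by exact_mod_cast hn
  have hHpos : 0 < H := lt_of_lt_of_le (by positivity) hH
  have h0 : ∀ i, 0 ≤ h i := fun i => ENNReal.toReal_nonneg
  -- A coin with probability `p` on a coordinate of size `n * w * C` has variance `(n * w * C)^2 *
  -- (1 - p) / p`. With `p = b i` this is at most `σ^2`.
  set b : Fin n → ℝ := fun i => (n * (h i / H) * C / σ) ^ 2 with hb
  have hmul : ∀ cnt, feasible cnt → ∀ i, h i * cnt i ≤ 1 := by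
    intro cnt hc i
    have h1 : (M i)⁻¹ * (cnt i : ℝ≥0∞) ≤ 1 := by
      refine (mul_le_mul_right (hcnt cnt hc i) _).trans ?_
      rw [mul_comm]
      exact ENNReal.mul_inv_le_one _
    have h2 := ENNReal.toReal_mono ENNReal.one_ne_top h1
    simpa [hh] using h2
  refine ⟨fun i => h i / H, fun i => min 1 (b i), ?_, ?_, ?_, ?_, ?_, ?_, ?_⟩
  · intro i; exact div_nonneg (h0 i) hHpos.le
  · rw [← Finset.sum_div, div_self hHpos.ne']
  · intro i; exact le_min zero_le_one (sq_nonneg _)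
  · intro i; exact min_le_left _ _
  · intro i hi
    have : b i = 0 := by
      rcases min_choice 1 (b i) with h' | h' <;> rw [h'] at hi
      · exact absurd hi one_ne_zero
      · exact hi
    have h3 := pow_eq_zero_iff (two_ne_zero) |>.1 this
    rcases div_eq_zero_iff.1 h3 with h4 | h4
    · rcases mul_eq_zero.1 h4 with h5 | h5
      · rcases mul_eq_zero.1 h5 with h6 | h6
        · exact absurd h6 hn'.ne'
        · exact h6
      · exact absurd h5 hC.ne'
    · exact absurd h4 hσ.ne'
  · intro i
    rcases le_total 1 (b i) with h1 | h1
    · simp only [min_eq_left h1]; simpa using sq_nonneg σ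
    · simp only [min_eq_right h1]
      have h2 : b i * σ ^ 2 = (n * (h i / H)) ^ 2 * C ^ 2 := by
        simp only [hb]; field_simp
      rw [h2]
      exact mul_le_of_le_one_right (by positivity) (by linarith [sq_nonneg (n * (h i / H) * C / σ)])
  · intro cnt hc
    have h1 : ∀ i, min 1 (b i) * cnt i ≤ (n * C / σ) ^ 2 / H ^ 2 * h i := by
      intro i
      calc min 1 (b i) * cnt i ≤ b i * cnt i := by
            gcongr; exact min_le_right _ _
        _ = (n * C / σ) ^ 2 / H ^ 2 * h i * (h i * cnt i) := by simp only [hb]; field_simp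
        _ ≤ _ := mul_le_of_le_one_right (mul_nonneg (by positivity) (h0 i)) (hmul cnt hc i)
    refine (Finset.sum_le_sum fun i _ => h1 i).trans ?_
    rw [← Finset.mul_sum, ← hHdef]
    have : (n * C / σ) ^ 2 / H ^ 2 * H = (n * C / σ) ^ 2 / H := by field_simp
    rw [this, div_le_iff₀ hHpos]
    linarith

/-- Counts of computations that can be completed between the times `s` and `s'`. -/
def FeasibleCount {n : ℕ} (v : Fin n → ℝ≥0 → ℝ≥0) (s s' : ℝ≥0∞) (cnt : Fin n → ℕ) : Prop :=
  ∀ i, cnt i ≠ 0 → ∃ t : ℝ≥0, (t : ℝ≥0∞) < s' ∧ (cnt i : ℝ≥0∞) ≤ V (v i) t - V (v i) s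

/-- Either some worker completes nothing before the round ends and takes all the weight, or every
worker completes something. In the latter case the threshold exceeds `1`, so it is the noise term,
and the harmonic weights work. -/
lemma exists_isProfile {n : ℕ} (hn : 0 < n) {v : Fin n → ℝ≥0 → ℝ≥0}
    (hv : ∀ i, IsComputationPower (v i)) {σ ε : ℝ} (hε : 0 < ε) (hσ : 0 ≤ σ) (r : ℕ) :
    ∃ w p, IsProfile (FeasibleCount v (lowerTime v (1 / 256) 1 σ ε r)
      (lowerTime v (1 / 256) 1 σ ε (r + 1))) (8 * √ε) σ w p := by
  set s := lowerTime v (1 / 256) 1 σ ε r with hs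
  set s' := lowerTime v (1 / 256) 1 σ ε (r + 1) with hs'
  set F : Fin n → ℝ≥0 → ℕ := fun i t => ⌊1 * (V (v i) t - V (v i) s).toReal⌋₊ with hF
  have hfin : ∀ i (t : ℝ≥0), V (v i) t - V (v i) s ≠ ⊤ := fun i t =>
    (tsub_le_self.trans_lt ((hv i).finite t)).ne
  have hFle : ∀ i (t : ℝ≥0) (m : ℕ), (m : ℝ≥0∞) ≤ V (v i) t - V (v i) s → m ≤ F i t := by
    intro i t m hm
    refine Nat.le_floor ?_
    rw [one_mul]
    simpa using ENNReal.toReal_mono (hfin i t) hm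
  have hFmono : ∀ i, Monotone (F i) := fun i t t' htt => by
    refine Nat.floor_le_floor ?_
    rw [one_mul, one_mul]
    exact ENNReal.toReal_mono (hfin i t') (tsub_le_tsub_right
      (V_mono _ (ENNReal.coe_le_coe.2 htt)) _)
  by_cases hcase : ∃ i₀, ∀ t : ℝ≥0, (t : ℝ≥0∞) < s' → F i₀ t = 0
  · obtain ⟨i₀, h₀⟩ := hcase
    refine ⟨_, _, isProfile_single _ _ i₀ fun cnt hc => ?_⟩
    by_contra hne
    obtain ⟨t, ht, hle⟩ := hc i₀ hne
    exact hne (Nat.le_zero.1 (h₀ t ht ▸ hFle i₀ t _ hle))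
  · push Not at hcase
    choose τ hτ hτF using hcase
    have : Nonempty (Fin n) := ⟨⟨0, hn⟩⟩
    have hn' : (0 : ℝ) < n := by exact_mod_cast hn
    obtain ⟨i₁, hi₁⟩ := Finite.exists_max τ
    set t₁ := τ i₁ with ht₁
    have hF1 : ∀ i, 1 ≤ F i t₁ := fun i =>
      (Nat.one_le_iff_ne_zero.2 (hτF i)).trans (hFmono i (hi₁ i))
    set b : ℝ := max (1 / 256 * (σ ^ 2 / (n * ε))) 1 with hb
    have hwork : ∀ t : ℝ≥0, (t : ℝ≥0∞) < s' →
        (ENNReal.ofReal b)⁻¹ < (n : ℝ≥0∞)⁻¹ * ∑ i, ((F i t : ℕ) : ℝ≥0∞)⁻¹ := by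
      intro t ht
      have := harmonicWork_lt_of_lt (v := v) ht
      rw [← ENNReal.inv_lt_inv, harmonicWork, inv_inv] at this
      exact this
    -- At `t₁` every floor is at least `1`, so the harmonic mean is at least `1`, while before the
    -- end of the round it is below `b`.
    have hb1 : 1 < b := by
      have h1 := hwork t₁ (hτ i₁)
      have h2 : (n : ℝ≥0∞)⁻¹ * ∑ i, ((F i t₁ : ℕ) : ℝ≥0∞)⁻¹ ≤ 1 := by
        have : ∑ i, ((F i t₁ : ℕ) : ℝ≥0∞)⁻¹ ≤ ∑ i : Fin n, 1 := Finset.sum_le_sum fun i _ =>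
          ENNReal.inv_le_one.2 (by exact_mod_cast hF1 i)
        refine (mul_le_mul_right this _).trans ?_
        simp only [Finset.sum_const, Finset.card_univ, Fintype.card_fin, nsmul_eq_mul, mul_one]
        rw [mul_comm]; exact ENNReal.mul_inv_le_one _
      have h3 := h1.trans_le h2
      rw [ENNReal.inv_lt_one] at h3
      exact_mod_cast ENNReal.one_lt_ofReal.1 h3
    have hbσ : b = 1 / 256 * (σ ^ 2 / (n * ε)) := by
      rcases max_choice (1 / 256 * (σ ^ 2 / (n * ε))) 1 with h | h
      · rw [hb, h]
      · rw [hb, h] at hb1; exact absurd hb1 (lt_irrefl _)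
    have hσpos : 0 < σ := by
      refine hσ.lt_of_ne fun h => ?_
      rw [hbσ, ← h] at hb1
      norm_num at hb1
    set ι := {t : ℝ≥0 // (t : ℝ≥0∞) < s' ∧ t₁ ≤ t} with hι
    have : Nonempty ι := ⟨⟨t₁, hτ i₁, le_rfl⟩⟩
    set M : Fin n → ℝ≥0∞ := fun i => ⨆ t : ι, (F i t : ℝ≥0∞) with hM
    have hM1 : ∀ i, 1 ≤ M i := fun i => le_trans (by exact_mod_cast hF1 i)
      (le_iSup (fun t : ι => (F i t : ℝ≥0∞)) ⟨t₁, hτ i₁, le_rfl⟩)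
    -- The strict bounds at times before `s'` pass to the suprema `M i`, which may be infinite. By
    -- monotonicity in `t` the infimum commutes with the finite sum.
    have hsum : (ENNReal.ofReal b)⁻¹ ≤ (n : ℝ≥0∞)⁻¹ * ∑ i, (M i)⁻¹ := by
      have h1 : ∑ i, (M i)⁻¹ = ⨅ t : ι, ∑ i, ((F i t : ℕ) : ℝ≥0∞)⁻¹ := by
        rw [ENNReal.iInf_sum]
        · refine Finset.sum_congr rfl fun i _ => ?_
          rw [hM, ENNReal.inv_iSup]
        · intro _ t t'
          rcases le_total t.1 t'.1 with h | h
          · refine ⟨t', fun i _ => ?_⟩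
            have : ((F i t'.1 : ℕ) : ℝ≥0∞)⁻¹ ≤ ((F i t.1 : ℕ) : ℝ≥0∞)⁻¹ :=
              ENNReal.inv_le_inv.2 (by exact_mod_cast hFmono i h)
            exact ⟨this, le_rfl⟩
          · refine ⟨t, fun i _ => ?_⟩
            have : ((F i t.1 : ℕ) : ℝ≥0∞)⁻¹ ≤ ((F i t'.1 : ℕ) : ℝ≥0∞)⁻¹ :=
              ENNReal.inv_le_inv.2 (by exact_mod_cast hFmono i h)
            exact ⟨le_rfl, this⟩
      rw [h1, ENNReal.mul_iInf_of_ne (by simp) (by simpa using hn.ne')]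
      exact le_iInf fun t => (hwork t.1 t.2.1).le
    refine isProfile_harmonic hσpos M ?_ (by positivity) hn ?_
    · intro cnt hc i
      by_cases h0 : cnt i = 0
      · simp [h0]
      · obtain ⟨t, ht, hle⟩ := hc i h0
        have h2 : cnt i ≤ F i (max t t₁) := (hFle i t _ hle).trans (hFmono i (le_max_left _ _))
        refine le_trans (Nat.cast_le.2 h2)
          (le_iSup (fun t : ι => (F i t : ℝ≥0∞)) ⟨max t t₁, ?_, le_max_right _ _⟩)
        rcases max_choice t t₁ with h | h <;> rw [h]
        · exact ht
        · exact hτ i₁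
    · have hMfin : ∀ i ∈ Finset.univ, (M i)⁻¹ ≠ ⊤ := fun i _ =>
        ENNReal.inv_ne_top.2 (zero_lt_one.trans_le (hM1 i)).ne'
      rw [← ENNReal.toReal_sum hMfin]
      have h3 := ENNReal.toReal_mono (ENNReal.mul_ne_top (by simpa using hn.ne')
        (ENNReal.sum_ne_top.2 hMfin)) hsum
      rw [ENNReal.toReal_inv, ENNReal.toReal_ofReal (by linarith), ENNReal.toReal_mul,
        ENNReal.toReal_inv, ENNReal.toReal_natCast, hbσ] at h3
      -- This fixes the constant `1/256`: `4 * 8^2 = 256`.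
      have h4 : 4 * (n * (8 * √ε) / σ) ^ 2 = n * (1 / 256 * (σ ^ 2 / (n * ε)))⁻¹ := by
        rw [div_pow, mul_pow, mul_pow, Real.sq_sqrt hε.le]
        field_simp
        norm_num
      rw [h4]
      calc (n : ℝ) * (1 / 256 * (σ ^ 2 / (n * ε)))⁻¹ ≤
          n * ((n : ℝ)⁻¹ * (∑ i, (M i)⁻¹).toReal) := by gcongr
        _ = _ := by field_simp

/-! ### The resisting oracle -/

/-- The data of the resisting oracle: scaling of the chain, weights and success probabilities of
the workers in every round, and the round in which a time lies. -/
structure Resisting (n : ℕ) where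
  scale : ℝ
  lam : ℝ
  weight : ℕ → Fin n → ℝ
  prob : ℕ → Fin n → ℝ
  round : ℝ≥0 → ℕ

/-- The state of the simulated protocol after `k` iterations: the vectors received, the states of
the oracles, the number `m` of discovered coordinates, and for each link of the chain the round in
which it became active (`0` if it did not yet). -/
abbrev SimState (n d k : ℕ) : Type :=
  ((Fin k → EuclideanSpace ℝ (Fin d)) × (Fin n → OracleState d)) × (ℕ × (ℕ → ℕ))

section Simulation

variable {n d : ℕ} (Z : Resisting n) (v : Fin n → ℝ≥0 → ℝ≥0) (A : Algorithm n d)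

/-- The local function of worker `i` if link `j` became active in round `R j`. -/
def localFun (R : ℕ → ℕ) (i : Fin n) : EuclideanSpace ℝ (Fin d) → ℝ :=
  chainFun Z.scale Z.lam fun j => n * Z.weight (R j) i

/-- The gradient of `localFun`. -/
def localGrad (R : ℕ → ℕ) (i : Fin n) (x : EuclideanSpace ℝ (Fin d)) :
    EuclideanSpace ℝ (Fin d) :=
  chainGrad Z.scale Z.lam (fun j => n * Z.weight (R j) i) x

/-- The stochastic gradient: if `x` lies in the span of the `m` discovered coordinates, then
coordinate `m` of the gradient is randomized by a coin `b`. -/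
def noisyGrad (m : ℕ) (R : ℕ → ℕ) (i : Fin n) (b : Prop) (x : EuclideanSpace ℝ (Fin d)) :
    EuclideanSpace ℝ (Fin d) :=
  open scoped Classical in
  if SuppBelow m x then
    WithLp.toLp 2 fun c => if (c : ℕ) = m then
      (if b then (Z.prob (R m) i)⁻¹ * localGrad Z R i x c else 0) else localGrad Z R i x c
  else localGrad Z R i x

/-- The answer to the query of the algorithm in the simulated protocol. -/
def simAnswer {k : ℕ} (S : SimState n d k) (b : Prop) :
    OracleState d × EuclideanSpace ℝ (Fin d) :=
  oracle (v (A k S.1.1).worker) (fun x _ => noisyGrad Z S.2.1 S.2.2 (A k S.1.1).worker b x)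
    (A k S.1.1).time (A k S.1.1).point (S.1.2 (A k S.1.1).worker) (A k S.1.1).cancel

/-- Coordinate `m` is discovered by the answer to the query. -/
def Discovers {k : ℕ} (S : SimState n d k) (b : Prop) : Prop :=
  ∃ c : Fin d, (c : ℕ) = S.2.1 ∧ (simAnswer Z v A S b).2 c ≠ 0

/-- One iteration of the simulated protocol with coin `b`. -/
def simStep {k : ℕ} (S : SimState n d k) (b : Prop) : SimState n d (k + 1) :=
  open scoped Classical in
  ((Fin.snoc S.1.1 (simAnswer Z v A S b).2,
      Function.update S.1.2 (A k S.1.1).worker (simAnswer Z v A S b).1),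
    if Discovers Z v A S b then
      (S.2.1 + 1, Function.update S.2.2 (S.2.1 + 1) (Z.round (A k S.1.1).time))
    else S.2)

/-- The success probability of the coin of the next iteration. -/
def coinProb {k : ℕ} (S : SimState n d k) : ℝ := Z.prob (S.2.2 S.2.1) (A k S.1.1).worker

/-- The simulated protocol for the outcome `ω`. -/
def sim (ω : ℕ → unitInterval) : (k : ℕ) → SimState n d k
  | 0 => ((Fin.elim0, fun _ => idle d), (0, fun _ => 0))
  | k + 1 => simStep Z v A (sim ω k) ((ω k : ℝ) < coinProb Z A (sim ω k))

/-- The rounds in which the links become active in the whole run. -/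
def finalRounds (ω : ℕ → unitInterval) (j : ℕ) : ℕ := ⨆ k, (sim Z v A ω k).2.2 j

/-- The stochastic gradient mappings. The random element consists of the number of discovered
coordinates, the activation rounds, and a uniform variable. -/
def stochGrad (i : Fin n) (x : EuclideanSpace ℝ (Fin d))
    (ζ : (ℕ × (ℕ → ℕ)) × unitInterval) (_ : ℝ≥0) : EuclideanSpace ℝ (Fin d) :=
  noisyGrad Z ζ.1.1 ζ.1.2 i ((ζ.2 : ℝ) < Z.prob (ζ.1.2 ζ.1.1) i) x

/-- The random elements. -/
def randomElement (k : ℕ) (ω : ℕ → unitInterval) : (ℕ × (ℕ → ℕ)) × unitInterval :=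
  (((sim Z v A ω k).2.1, finalRounds Z v A ω), ω k)

/-- The invariants of the simulated protocol. -/
structure SimInv {k : ℕ} (S : SimState n d k) : Prop where
  hist : ∀ j, SuppBelow S.2.1 (S.1.1 j)
  state : ∀ i, SuppBelow S.2.1 (S.1.2 i).point
  future : ∀ j, S.2.1 < j → S.2.2 j = 0
  le_dim : S.2.1 ≤ d

/-! ### Locality and invariants of the simulated run. -/

variable {Z v A}

lemma gradient_localFun (R : ℕ → ℕ) (i : Fin n) (x : EuclideanSpace ℝ (Fin d)) :
    gradient (localFun Z R i) x = localGrad Z R i x := gradient_chainFun _ _ _ _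

lemma localGrad_congr {m : ℕ} {R R' : ℕ → ℕ} (i : Fin n) {x : EuclideanSpace ℝ (Fin d)}
    (hx : SuppBelow m x) (hR : ∀ j ≤ m, R j = R' j) :
    localGrad Z R i x = localGrad Z R' i x :=
  chainGrad_congr hx fun j hj => by rw [hR j hj]

lemma noisyGrad_congr {m : ℕ} {R R' : ℕ → ℕ} (i : Fin n) (b : Prop)
    {x : EuclideanSpace ℝ (Fin d)} (hx : SuppBelow m x) (hR : ∀ j ≤ m, R j = R' j) :
    noisyGrad Z m R i b x = noisyGrad Z m R' i b x := by
  simp only [noisyGrad, localGrad_congr i hx hR, hR m le_rfl]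

lemma suppBelow_noisyGrad {m : ℕ} {R : ℕ → ℕ} {i : Fin n} {b : Prop}
    {x : EuclideanSpace ℝ (Fin d)} (hx : SuppBelow m x) :
    SuppBelow (m + 1) (noisyGrad Z m R i b x) := by
  intro c hc
  have hne : (c : ℕ) ≠ m := by omega
  simp only [noisyGrad, if_pos hx, if_neg hne]
  exact chainGrad_apply_of_lt hx (by omega)

/-- Besides a successful coin, a discovery needs a point that already uses variable `m`. This
excludes computations started before the current link became active. -/
lemma of_noisyGrad_apply_ne_zero {m : ℕ} {R : ℕ → ℕ} {i : Fin n} {b : Prop}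
    {x : EuclideanSpace ℝ (Fin d)} (hx : SuppBelow m x) {c : Fin d} (hc : (c : ℕ) = m)
    (h : noisyGrad Z m R i b x c ≠ 0) : b ∧ chainVar Z.lam x m ≠ 0 := by
  subst hc
  simp only [noisyGrad, if_pos hx, if_true] at h
  have hb : b := by
    by_contra hb
    simp [hb] at h
  refine ⟨hb, fun h0 => h ?_⟩
  rw [if_pos hb, localGrad, chainGrad_apply_frontier hx, h0, gate_zero]
  simp

/-- The oracle returns either `0` or the stochastic gradient at the stored point. -/
lemma oracle_snd_eq (u : ℝ≥0 → ℝ≥0)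
    (γ : EuclideanSpace ℝ (Fin d) → ℝ≥0 → EuclideanSpace ℝ (Fin d))
    (t : ℝ≥0) (x : EuclideanSpace ℝ (Fin d)) (s : OracleState d) (c : Bool) :
    (oracle u γ t x s c).2 = 0 ∨ (oracle u γ t x s c = (idle d, γ s.point t) ∧ c = false ∧
      s.busy = true ∧ 1 ≤ V u t - V u s.time) := by
  unfold oracle
  split_ifs with h1 h2 h3
  · exact Or.inl rfl
  · exact Or.inl rfl
  · exact Or.inl rfl
  · exact Or.inr ⟨rfl, by simpa using h1, by simpa using h2, not_lt.1 h3⟩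

lemma oracle_fst_point (u : ℝ≥0 → ℝ≥0)
    (γ : EuclideanSpace ℝ (Fin d) → ℝ≥0 → EuclideanSpace ℝ (Fin d))
    (t : ℝ≥0) (x : EuclideanSpace ℝ (Fin d)) (s : OracleState d) (c : Bool) :
    (oracle u γ t x s c).1.point = 0 ∨ (oracle u γ t x s c).1.point = x ∨
      (oracle u γ t x s c).1.point = s.point := by
  unfold oracle
  split_ifs <;> simp [idle]

lemma oracle_congr (u : ℝ≥0 → ℝ≥0)
    {γ γ' : EuclideanSpace ℝ (Fin d) → ℝ≥0 → EuclideanSpace ℝ (Fin d)}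
    (t : ℝ≥0) (x : EuclideanSpace ℝ (Fin d)) {s : OracleState d} (c : Bool)
    (h : γ s.point t = γ' s.point t) : oracle u γ t x s c = oracle u γ' t x s c := by
  unfold oracle
  split_ifs <;> simp [h]

lemma simAnswer_snd_eq {k : ℕ} (S : SimState n d k) (b : Prop) :
    (simAnswer Z v A S b).2 = 0 ∨
      (simAnswer Z v A S b = (idle d, noisyGrad Z S.2.1 S.2.2 (A k S.1.1).worker b
        (S.1.2 (A k S.1.1).worker).point) ∧ (A k S.1.1).cancel = false ∧
      (S.1.2 (A k S.1.1).worker).busy = true ∧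
      1 ≤ V (v (A k S.1.1).worker) (A k S.1.1).time -
        V (v (A k S.1.1).worker) (S.1.2 (A k S.1.1).worker).time) :=
  oracle_snd_eq _ _ _ _ _ _

lemma suppBelow_point (hA : IsZeroRespecting A) {k : ℕ} {S : SimState n d k} (hS : SimInv S) :
    SuppBelow S.2.1 (A k S.1.1).point := by
  intro c hc
  by_contra hne
  obtain ⟨j, hj⟩ := hA.support k S.1.1 c hne
  exact hj (hS.hist j c hc)

lemma suppBelow_simAnswer {k : ℕ} {S : SimState n d k} (hS : SimInv S) (b : Prop) :
    SuppBelow (S.2.1 + 1) (simAnswer Z v A S b).2 := by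
  rcases simAnswer_snd_eq (Z := Z) (v := v) (A := A) S b with h | h
  · rw [h]; exact suppBelow_zero _
  · rw [h.1]; exact suppBelow_noisyGrad (hS.state _)

lemma suppBelow_simAnswer_of_not {k : ℕ} {S : SimState n d k} (hS : SimInv S) {b : Prop}
    (hb : ¬ Discovers Z v A S b) : SuppBelow S.2.1 (simAnswer Z v A S b).2 := by
  intro c hc
  rcases hc.eq_or_lt with h | h
  · by_contra hne
    exact hb ⟨c, h.symm, hne⟩
  · exact suppBelow_simAnswer hS b c h

lemma le_simStep {k : ℕ} (S : SimState n d k) (b : Prop) : S.2.1 ≤ (simStep Z v A S b).2.1 := by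
  unfold simStep
  split_ifs <;> simp

lemma simStep_rounds {k : ℕ} (S : SimState n d k) (b : Prop) {j : ℕ} (hj : j ≤ S.2.1) :
    (simStep Z v A S b).2.2 j = S.2.2 j := by
  unfold simStep
  split_ifs
  · simp only
    rw [Function.update_of_ne (by omega)]
  · rfl

lemma SimInv.step (hA : IsZeroRespecting A) {k : ℕ} {S : SimState n d k} (hS : SimInv S)
    (b : Prop) : SimInv (simStep Z v A S b) := by
  have hle := le_simStep (Z := Z) (v := v) (A := A) S b
  refine ⟨?_, ?_, ?_, ?_⟩
  · refine Fin.lastCases ?_ fun j => ?_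
    · by_cases hd : Discovers Z v A S b
      · simpa [simStep, hd] using suppBelow_simAnswer hS b
      · simpa [simStep, hd] using suppBelow_simAnswer_of_not hS hd
    · have : (simStep Z v A S b).1.1 j.castSucc = S.1.1 j := by simp [simStep]
      rw [this]
      exact (hS.hist j).mono hle
  · intro i
    by_cases hi : i = (A k S.1.1).worker
    · have : (simStep Z v A S b).1.2 i = (simAnswer Z v A S b).1 := by simp [simStep, hi]
      rw [this]
      refine SuppBelow.mono hle ?_
      rcases oracle_fst_point (v (A k S.1.1).worker)
        (fun x _ => noisyGrad Z S.2.1 S.2.2 (A k S.1.1).worker b x)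
        (A k S.1.1).time (A k S.1.1).point (S.1.2 (A k S.1.1).worker) (A k S.1.1).cancel
        with h | h | h
      · rw [simAnswer, h]; exact suppBelow_zero _
      · rw [simAnswer, h]; exact suppBelow_point hA hS
      · rw [simAnswer, h]; exact hS.state _
    · have : (simStep Z v A S b).1.2 i = S.1.2 i := by simp [simStep, hi]
      rw [this]
      exact (hS.state i).mono hle
  · intro j hj
    by_cases hd : Discovers Z v A S b
    · simp only [simStep, hd, if_true] at hj ⊢
      rw [Function.update_of_ne (by omega)]
      exact hS.future j (by omega)
    · simp only [simStep, hd, if_false] at hj ⊢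
      exact hS.future j hj
  · by_cases hd : Discovers Z v A S b
    · simp only [simStep, hd, if_true]
      obtain ⟨c, hc, -⟩ := hd
      omega
    · simp only [simStep, hd, if_false]
      exact hS.le_dim

lemma simInv_sim (hA : IsZeroRespecting A) (ω : ℕ → unitInterval) (k : ℕ) :
    SimInv (sim Z v A ω k) := by
  induction k with
  | zero => exact ⟨fun j => j.elim0, fun _ => suppBelow_zero _, fun _ _ => rfl, Nat.zero_le _⟩
  | succ k ih => exact ih.step hA _

lemma sim_rounds_of_le (ω : ℕ → unitInterval) {k l : ℕ} (hkl : k ≤ l) :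
    (sim Z v A ω k).2.1 ≤ (sim Z v A ω l).2.1 ∧
      ∀ j ≤ (sim Z v A ω k).2.1, (sim Z v A ω l).2.2 j = (sim Z v A ω k).2.2 j := by
  induction l, hkl using Nat.le_induction with
  | base => exact ⟨le_rfl, fun _ _ => rfl⟩
  | succ l _ ih =>
    refine ⟨ih.1.trans (le_simStep _ _), fun j hj => ?_⟩
    rw [← ih.2 j hj]
    exact simStep_rounds _ _ (hj.trans ih.1)

/-- The recorded round of a link is `0` until the link becomes active and frozen afterwards, so the
supremum over the run is the frozen value. -/
lemma finalRounds_eq (hA : IsZeroRespecting A) (ω : ℕ → unitInterval) {k j : ℕ}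
    (hj : j ≤ (sim Z v A ω k).2.1) :
    finalRounds Z v A ω j = (sim Z v A ω k).2.2 j := by
  have hub : ∀ l, (sim Z v A ω l).2.2 j ≤ (sim Z v A ω k).2.2 j := by
    intro l
    rcases le_total k l with h | h
    · rw [(sim_rounds_of_le ω h).2 j hj]
    · by_cases hjl : j ≤ (sim Z v A ω l).2.1
      · rw [(sim_rounds_of_le ω h).2 j hjl]
      · rw [(simInv_sim hA ω l).future j (not_le.1 hjl)]
        exact Nat.zero_le _
  exact le_antisymm (ciSup_le hub)
    (le_ciSup (f := fun l => (sim Z v A ω l).2.2 j) ⟨_, Set.forall_mem_range.2 hub⟩ k)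

/-- The simulated protocol is the protocol with the stochastic gradients `stochGrad`. -/
lemma run_eq_sim (hA : IsZeroRespecting A) (ω : ℕ → unitInterval) (k : ℕ) :
    run v A (realize (stochGrad Z) (randomElement Z v A) ω) k = (sim Z v A ω k).1 := by
  induction k with
  | zero => rfl
  | succ k ih =>
    have hR : ∀ j ≤ (sim Z v A ω k).2.1, finalRounds Z v A ω j = (sim Z v A ω k).2.2 j :=
      fun j hj => finalRounds_eq hA ω hj
    simp only [run, ih, sim, simStep]
    have h : oracle (v (A k (sim Z v A ω k).1.1).worker)
        (realize (stochGrad Z) (randomElement Z v A) ω k (A k (sim Z v A ω k).1.1).worker)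
        (A k (sim Z v A ω k).1.1).time (A k (sim Z v A ω k).1.1).point
        ((sim Z v A ω k).1.2 (A k (sim Z v A ω k).1.1).worker)
        (A k (sim Z v A ω k).1.1).cancel =
        simAnswer Z v A (sim Z v A ω k) ((ω k : ℝ) < coinProb Z A (sim Z v A ω k)) := by
      -- The oracle evaluates the mapping only at the stored point. This point lies in the
      -- discovered coordinates, where the final and the current rounds give the same gradient.
      refine oracle_congr _ _ _ _ ?_
      simp only [realize, stochGrad, randomElement, coinProb]
      rw [hR _ le_rfl]
      exact noisyGrad_congr _ _ ((simInv_sim hA ω k).state _) hR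
    rw [h]

lemma transcript_eq_sim (hA : IsZeroRespecting A) (ω : ℕ → unitInterval) (k : ℕ) :
    transcript v A (realize (stochGrad Z) (randomElement Z v A) ω) k = (sim Z v A ω k).1.1 := by
  rw [transcript, run_eq_sim hA]

lemma iterate_eq_sim (hA : IsZeroRespecting A) (ω : ℕ → unitInterval) (k : ℕ) :
    iterate v A (realize (stochGrad Z) (randomElement Z v A) ω) k =
      (A k (sim Z v A ω k).1.1).point := by
  rw [iterate, transcript_eq_sim hA]

lemma sim_rounds_le {K : ℕ} (hK : ∀ t, Z.round t ≤ K) (ω : ℕ → unitInterval) (k j : ℕ) :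
    (sim Z v A ω k).2.2 j ≤ K := by
  induction k with
  | zero => exact Nat.zero_le _
  | succ k ih =>
    simp only [sim, simStep]
    split_ifs
    · by_cases hj : j = (sim Z v A ω k).2.1 + 1
      · subst hj; simpa using hK _
      · simpa [Function.update_of_ne hj] using ih
    · exact ih

lemma finalRounds_le {K : ℕ} (hK : ∀ t, Z.round t ≤ K) (ω : ℕ → unitInterval) (j : ℕ) :
    finalRounds Z v A ω j ≤ K := ciSup_le fun k => sim_rounds_le hK ω k j

lemma finalRounds_eq_zero (hA : IsZeroRespecting A) (ω : ℕ → unitInterval) {j : ℕ} (hj : d < j) :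
    finalRounds Z v A ω j = 0 :=
  Nat.le_zero.1 (ciSup_le fun k => ((simInv_sim hA ω k).future j
    ((simInv_sim hA ω k).le_dim.trans_lt hj)).le)

/-- Only the links up to `d` can become active, and rounds are capped at `K`. -/
lemma finite_range_finalRounds (hA : IsZeroRespecting A) {K : ℕ} (hK : ∀ t, Z.round t ≤ K) :
    (Set.range (finalRounds Z v A)).Finite := by
  refine (Set.finite_range (fun (ρ : Fin (d + 1) → Fin (K + 1)) (j : ℕ) =>
    if h : j < d + 1 then (ρ ⟨j, h⟩ : ℕ) else 0)).subset ?_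
  rintro _ ⟨ω, rfl⟩
  refine ⟨fun j => ⟨finalRounds Z v A ω j, Nat.lt_succ_of_le (finalRounds_le hK ω j)⟩, ?_⟩
  funext j
  by_cases h : j < d + 1
  · simp [h]
  · simp [h, finalRounds_eq_zero hA ω (show d < j by omega)]

/-- The algorithm is deterministic and each coin has two outcomes. Finitely many states make every
function of the state integrable, with no measurability assumption on the algorithm. -/
lemma finite_range_sim (k : ℕ) : (Set.range fun ω => sim Z v A ω k).Finite := by
  induction k with
  | zero => exact (Set.finite_singleton _).subset (Set.range_subset_iff.2 fun ω => rfl)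
  | succ k ih =>
    refine ((ih.prod (Set.finite_univ (α := Prop))).image
      fun y => simStep Z v A y.1 y.2).subset ?_
    rintro _ ⟨ω, rfl⟩
    exact ⟨(sim Z v A ω k, (ω k : ℝ) < coinProb Z A (sim Z v A ω k)),
      ⟨⟨ω, rfl⟩, Set.mem_univ _⟩, rfl⟩

end Simulation

/-! ### Maps with finitely many values -/

/-- A map with finite range all of whose preimages are measurable. -/
structure IsSimpleMap {Ω α : Type*} [MeasurableSpace Ω] (T : Ω → α) : Prop where
  finite_range : (Set.range T).Finite
  measurableSet : ∀ B : Set α, MeasurableSet (T ⁻¹' B)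

section SimpleMap

variable {Ω α β : Type*} [MeasurableSpace Ω]

lemma IsSimpleMap.of_singleton {T : Ω → α} (h : (Set.range T).Finite)
    (hT : ∀ a, MeasurableSet (T ⁻¹' {a})) : IsSimpleMap T := by
  refine ⟨h, fun B => ?_⟩
  have : T ⁻¹' B = ⋃ a ∈ Set.range T ∩ B, T ⁻¹' {a} := by
    ext ω
    simp
  rw [this]
  exact (h.inter_of_left B).measurableSet_biUnion fun a _ => hT a

lemma IsSimpleMap.comp {T : Ω → α} (hT : IsSimpleMap T) (y : α → β) :
    IsSimpleMap fun ω => y (T ω) :=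
  ⟨(hT.finite_range.image y).subset (by rintro _ ⟨ω, rfl⟩; exact ⟨_, ⟨ω, rfl⟩, rfl⟩),
    fun B => hT.measurableSet (y ⁻¹' B)⟩

lemma IsSimpleMap.prodMk {T : Ω → α} {T' : Ω → β} (hT : IsSimpleMap T) (hT' : IsSimpleMap T') :
    IsSimpleMap fun ω => (T ω, T' ω) := by
  refine IsSimpleMap.of_singleton
    ((hT.finite_range.prod hT'.finite_range).subset ?_) fun a => ?_
  · rintro _ ⟨ω, rfl⟩
    exact ⟨⟨ω, rfl⟩, ⟨ω, rfl⟩⟩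
  · have : (fun ω => (T ω, T' ω)) ⁻¹' {a} = T ⁻¹' {a.1} ∩ T' ⁻¹' {a.2} := by
      ext ω
      simp [Prod.ext_iff]
    rw [this]
    exact (hT.measurableSet _).inter (hT'.measurableSet _)

lemma IsSimpleMap.measurable {T : Ω → α} (hT : IsSimpleMap T) [MeasurableSpace α] :
    Measurable T := fun B _ => hT.measurableSet B

lemma IsSimpleMap.integrable {F : Type*} [NormedAddCommGroup F] {T : Ω → F}
    (hT : IsSimpleMap T) (μ : Measure Ω) [IsFiniteMeasure μ] : Integrable T μ :=
  SimpleFunc.integrable_of_isFiniteMeasure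
    (⟨T, fun a => hT.measurableSet {a}, hT.finite_range⟩ : SimpleFunc Ω F)

lemma isSimpleMap_prop {p : Ω → Prop} (hp : MeasurableSet {ω | p ω}) : IsSimpleMap p := by
  refine IsSimpleMap.of_singleton (Set.toFinite _) fun a => ?_
  by_cases ha : a
  · have : p ⁻¹' {a} = {ω | p ω} := by ext ω; simp [ha]
    rw [this]; exact hp
  · have : p ⁻¹' {a} = {ω | p ω}ᶜ := by ext ω; simp [ha]
    rw [this]; exact hp.compl

end SimpleMap

/-! ### Measurability and independence -/

/-- The law of a sequence of independent uniform variables. -/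
def uniformSeq : Measure (ℕ → unitInterval) := Measure.infinitePi fun _ => volume

instance : IsProbabilityMeasure uniformSeq := by
  unfold uniformSeq; infer_instance

/-- The σ-algebra generated by the coordinates before `k`. -/
@[reducible]
def coordsBefore (k : ℕ) : MeasurableSpace (ℕ → unitInterval) :=
  ⨆ i ∈ Set.Iio k, MeasurableSpace.comap (fun ω : ℕ → unitInterval => ω i) inferInstance

lemma coordsBefore_mono {k l : ℕ} (h : k ≤ l) : coordsBefore k ≤ coordsBefore l :=
  biSup_mono fun _ hi => lt_of_lt_of_le hi h

lemma coordsBefore_le (k : ℕ) : coordsBefore k ≤ MeasurableSpace.pi :=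
  iSup₂_le fun i _ => (measurable_pi_apply i).comap_le

lemma measurable_coord (k : ℕ) :
    Measurable[coordsBefore (k + 1)] fun ω : ℕ → unitInterval => ω k := by
  rw [measurable_iff_comap_le]
  exact le_iSup₂_of_le k (Set.mem_Iio.2 (Nat.lt_succ_self k)) le_rfl

lemma indep_coordsBefore (k : ℕ) :
    ProbabilityTheory.Indep (coordsBefore k)
      (MeasurableSpace.comap (fun ω : ℕ → unitInterval => ω k) inferInstance) uniformSeq := by
  have h := ProbabilityTheory.iIndepFun_infinitePi (P := fun _ : ℕ => (volume : Measure unitInterval))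
    (X := fun _ u => u) (fun _ => measurable_id)
  have h2 := ProbabilityTheory.indep_iSup_of_disjoint
    (m := fun i => MeasurableSpace.comap (fun ω : ℕ → unitInterval => ω i) inferInstance)
    (fun i => (measurable_pi_apply i).comap_le) h
    (S := Set.Iio k) (T := {k}) (by simp)
  simp only [Set.mem_singleton_iff, iSup_iSup_eq_left] at h2
  exact h2

section Measurability

variable {n d : ℕ} {Z : Resisting n} {v : Fin n → ℝ≥0 → ℝ≥0} {A : Algorithm n d}

/-- The state before iteration `k` uses only the coins before `k`; this gives its independence from
coin `k`. -/
lemma measurableSet_sim_before (k : ℕ) :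
    ∀ B : Set (SimState n d k), MeasurableSet[coordsBefore k] ((fun ω => sim Z v A ω k) ⁻¹' B) := by
  induction k with
  | zero => intro B; exact @MeasurableSet.const _ (coordsBefore 0) (_ ∈ B)
  | succ k ih =>
    intro B
    have ih' : ∀ B : Set (SimState n d k),
        MeasurableSet[coordsBefore (k + 1)] ((fun ω => sim Z v A ω k) ⁻¹' B) :=
      fun B => coordsBefore_mono (Nat.le_succ k) _ (ih B)
    set C : Set (ℕ → unitInterval) := {ω | (ω k : ℝ) < coinProb Z A (sim Z v A ω k)} with hC
    have hCm : MeasurableSet[coordsBefore (k + 1)] C := by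
      refine @measurableSet_lt _ _ _ _ _ (coordsBefore (k + 1)) _ _ _ _ _ ?_ ?_
      · exact @Measurable.comp _ _ _ (coordsBefore (k + 1)) _ _ _ _ measurable_subtype_coe
          (measurable_coord k)
      · exact fun U _ => ih' (coinProb Z A ⁻¹' U)
    have heq : (fun ω => sim Z v A ω (k + 1)) ⁻¹' B =
        ((fun ω => sim Z v A ω k) ⁻¹' {S | simStep Z v A S True ∈ B} ∩ C) ∪
        ((fun ω => sim Z v A ω k) ⁻¹' {S | simStep Z v A S False ∈ B} \ C) := by
      ext ω
      by_cases hω : (ω k : ℝ) < coinProb Z A (sim Z v A ω k) <;> simp [sim, hC, hω]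
    rw [heq]
    exact @MeasurableSet.union _ (coordsBefore (k + 1)) _ _
      (@MeasurableSet.inter _ (coordsBefore (k + 1)) _ _ (ih' _) hCm)
      (@MeasurableSet.diff _ (coordsBefore (k + 1)) _ _ (ih' _) hCm)

lemma isSimpleMap_sim (k : ℕ) : IsSimpleMap fun ω => sim Z v A ω k :=
  ⟨finite_range_sim k, fun B => coordsBefore_le k _ (measurableSet_sim_before k B)⟩

lemma isSimpleMap_finalRounds (hA : IsZeroRespecting A) {K : ℕ} (hK : ∀ t, Z.round t ≤ K) :
    IsSimpleMap (finalRounds Z v A) := by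
  have hm : Measurable (finalRounds Z v A) := measurable_pi_lambda _ fun j =>
    Measurable.iSup fun k => ((isSimpleMap_sim k).comp fun S => S.2.2 j).measurable
  exact IsSimpleMap.of_singleton (finite_range_finalRounds hA hK)
    fun R => hm (measurableSet_singleton R)

lemma isSimpleMap_coin {k : ℕ} (pr : SimState n d k → ℝ) :
    IsSimpleMap fun ω : ℕ → unitInterval => (ω k : ℝ) < pr (sim Z v A ω k) :=
  isSimpleMap_prop (measurableSet_lt (measurable_subtype_coe.comp (measurable_pi_apply k))
    ((isSimpleMap_sim k).comp pr).measurable)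

lemma measure_sim_inter_coin {k : ℕ} (B : Set (SimState n d k)) {p : ℝ} (h0 : 0 ≤ p)
    (h1 : p ≤ 1) :
    uniformSeq.real ((fun ω => sim Z v A ω k) ⁻¹' B ∩ {ω | (ω k : ℝ) < p}) =
      uniformSeq.real ((fun ω => sim Z v A ω k) ⁻¹' B) * p := by
  have h := (ProbabilityTheory.Indep_iff _ _ _).1 (indep_coordsBefore k) _ _
    (measurableSet_sim_before (Z := Z) (v := v) (A := A) k B)
    (⟨Set.Iio (⟨p, h0, h1⟩ : unitInterval), measurableSet_Iio, rfl⟩ :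
      MeasurableSet[MeasurableSpace.comap (fun ω : ℕ → unitInterval => ω k) inferInstance]
        ((fun ω => ω k) ⁻¹' Set.Iio (⟨p, h0, h1⟩ : unitInterval)))
  have h2 : uniformSeq ((fun ω => ω k) ⁻¹' Set.Iio (⟨p, h0, h1⟩ : unitInterval)) =
      ENNReal.ofReal p := by
    have h3 := (measurePreserving_eval_infinitePi
      (fun _ : ℕ => (volume : Measure unitInterval)) k).measure_preimage
      (measurableSet_Iio (a := (⟨p, h0, h1⟩ : unitInterval))).nullMeasurableSet
    rw [unitInterval.volume_Iio] at h3
    exact h3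
  rw [h2] at h
  have h4 : {ω : ℕ → unitInterval | (ω k : ℝ) < p} =
      (fun ω => ω k) ⁻¹' Set.Iio (⟨p, h0, h1⟩ : unitInterval) := by
    ext ω
    exact Iff.rfl
  rw [measureReal_def, h4, h, ENNReal.toReal_mul, ENNReal.toReal_ofReal h0, measureReal_def]

/-- The coin of iteration `k` is independent of the state of the protocol. -/
lemma integral_coin {F : Type*} [NormedAddCommGroup F] [NormedSpace ℝ F] [CompleteSpace F] {k : ℕ}
    (h : SimState n d k → Prop → F) (pr : SimState n d k → ℝ) (h0 : ∀ S, 0 ≤ pr S)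
    (h1 : ∀ S, pr S ≤ 1) :
    ∫ ω, h (sim Z v A ω k) ((ω k : ℝ) < pr (sim Z v A ω k)) ∂uniformSeq =
      ∫ ω, (pr (sim Z v A ω k) • h (sim Z v A ω k) True +
        (1 - pr (sim Z v A ω k)) • h (sim Z v A ω k) False) ∂uniformSeq := by
  classical
  set T : (ℕ → unitInterval) → SimState n d k := fun ω => sim Z v A ω k with hT
  have hTs : IsSimpleMap T := isSimpleMap_sim k
  set y : SimState n d k → F := fun S => h S True - h S False with hy
  set r := hTs.finite_range.toFinset with hr
  have hmem : ∀ ω, T ω ∈ r := fun ω => by simp [hr]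
  have hset : ∀ s, MeasurableSet (T ⁻¹' {s} ∩ {ω | (ω k : ℝ) < pr s}) := fun s =>
    (hTs.measurableSet _).inter
      (measurableSet_lt (measurable_subtype_coe.comp (measurable_pi_apply k)) measurable_const)
  -- The integrand is split over the finitely many states, on each of which the success probability
  -- is a constant.
  have hL : ∀ ω, h (T ω) ((ω k : ℝ) < pr (T ω)) = h (T ω) False +
      ∑ s ∈ r, (T ⁻¹' {s} ∩ {ω | (ω k : ℝ) < pr s}).indicator (fun _ => y s) ω := by
    intro ω
    rw [Finset.sum_eq_single_of_mem (T ω) (hmem ω)]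
    · by_cases hω : (ω k : ℝ) < pr (T ω) <;> simp [Set.indicator, hω, hy]
    · intro s _ hs
      simp [Set.indicator, Ne.symm hs]
  have hR : ∀ ω, pr (T ω) • h (T ω) True + (1 - pr (T ω)) • h (T ω) False = h (T ω) False +
      ∑ s ∈ r, (T ⁻¹' {s}).indicator (fun _ => pr s • y s) ω := by
    intro ω
    rw [Finset.sum_eq_single_of_mem (T ω) (hmem ω)]
    · simp only [Set.indicator, Set.mem_preimage, Set.mem_singleton_iff, if_true, hy, smul_sub,
        sub_smul, one_smul]
      abel
    · intro s _ hs
      simp [Set.indicator, Ne.symm hs]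
  have hF : Integrable (fun ω => h (T ω) False) uniformSeq :=
    (hTs.comp fun S => h S False).integrable _
  have hi1 : ∀ s ∈ r, Integrable
      ((T ⁻¹' {s} ∩ {ω | (ω k : ℝ) < pr s}).indicator (fun _ => y s)) uniformSeq := fun s _ =>
    (integrable_const _).indicator (hset s)
  have hi2 : ∀ s ∈ r, Integrable ((T ⁻¹' {s}).indicator (fun _ => pr s • y s)) uniformSeq :=
    fun s _ => (integrable_const _).indicator (hTs.measurableSet _)
  refine (integral_congr_ae (Filter.Eventually.of_forall hL)).trans
    (Eq.trans ?_ (integral_congr_ae (Filter.Eventually.of_forall hR)).symm)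
  rw [integral_add hF (integrable_finsetSum _ hi1), integral_add hF (integrable_finsetSum _ hi2),
    integral_finsetSum _ hi1, integral_finsetSum _ hi2]
  congr 1
  refine Finset.sum_congr rfl fun s _ => ?_
  rw [integral_indicator_const _ (hset s), integral_indicator_const _ (hTs.measurableSet _),
    measure_sim_inter_coin _ (h0 s) (h1 s), smul_smul]

/-! ### The stochastic gradients are unbiased and have bounded variance -/

/-- The part of the gradient in coordinate `m`. -/
def frontierPart (Z : Resisting n) (m : ℕ) (R : ℕ → ℕ) (i : Fin n)
    (x : EuclideanSpace ℝ (Fin d)) : EuclideanSpace ℝ (Fin d) :=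
  WithLp.toLp 2 fun c => if (c : ℕ) = m then localGrad Z R i x c else 0

/-- The error of the stochastic gradient. -/
def gradError (Z : Resisting n) (m : ℕ) (R : ℕ → ℕ) (i : Fin n)
    (x : EuclideanSpace ℝ (Fin d)) (b : Prop) : EuclideanSpace ℝ (Fin d) :=
  open scoped Classical in
  if SuppBelow m x then
    (if b then (Z.prob (R m) i)⁻¹ - 1 else -1) • frontierPart Z m R i x
  else 0

lemma noisyGrad_sub_localGrad (m : ℕ) (R : ℕ → ℕ) (i : Fin n) (x : EuclideanSpace ℝ (Fin d))
    (b : Prop) :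
    noisyGrad Z m R i b x - localGrad Z R i x = gradError Z m R i x b := by
  classical
  unfold noisyGrad gradError
  split_ifs with h hb
  · ext c
    by_cases hc : (c : ℕ) = m
    · simp [frontierPart, hc, sub_mul]
    · simp [frontierPart, hc]
  · ext c
    by_cases hc : (c : ℕ) = m <;> simp [frontierPart, hc]
  · simp

lemma norm_sq_frontierPart_le {m : ℕ} {R : ℕ → ℕ} {i : Fin n} {x : EuclideanSpace ℝ (Fin d)}
    (hx : SuppBelow m x) :
    ‖frontierPart Z m R i x‖ ^ 2 ≤
      (n * Z.weight (R m) i) ^ 2 * (Z.scale * Z.lam⁻¹) ^ 2 := by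
  rw [EuclideanSpace.norm_sq_eq]
  by_cases hm : m < d
  · rw [Finset.sum_eq_single_of_mem (⟨m, hm⟩ : Fin d) (Finset.mem_univ _)]
    · simp only [frontierPart, if_true, localGrad]
      rw [chainGrad_apply_frontier (c := ⟨m, hm⟩) hx, norm_neg, Real.norm_eq_abs, sq_abs,
        mul_pow, mul_pow _ (gate _), mul_comm, mul_assoc]
      have hg : gate (chainVar Z.lam x m) ^ 2 ≤ 1 :=
        pow_le_one₀ (gate_nonneg _) (gate_le_one _)
      refine mul_le_mul_of_nonneg_left ?_ (sq_nonneg _)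
      exact mul_le_of_le_one_left (sq_nonneg _) hg
    · intro c _ hc
      have : (c : ℕ) ≠ m := fun h => hc (Fin.ext h)
      simp [frontierPart, this]
  · rw [Finset.sum_eq_zero]
    · positivity
    · intro c _
      have : (c : ℕ) ≠ m := fun h => hm (h ▸ c.2)
      simp [frontierPart, this]

/-- The conditions on weights and probabilities needed for unbiasedness and bounded variance. -/
structure Resisting.IsValid (Z : Resisting n) (σ : ℝ) : Prop where
  prob_nonneg : ∀ r i, 0 ≤ Z.prob r i
  prob_le_one : ∀ r i, Z.prob r i ≤ 1
  weight_eq_zero : ∀ r i, Z.prob r i = 0 → Z.weight r i = 0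
  variance : ∀ r i, (n * Z.weight r i) ^ 2 * (Z.scale * Z.lam⁻¹) ^ 2 * (1 - Z.prob r i) ≤
    Z.prob r i * σ ^ 2

/-- This covers the degenerate coin with `p = 0`, where rescaling by `p⁻¹` cannot restore the mean:
such a worker has weight `0`, so nothing is lost. -/
lemma frontierPart_eq_zero {σ : ℝ} (hZ : Z.IsValid σ) {m : ℕ} {R : ℕ → ℕ} {i : Fin n}
    {x : EuclideanSpace ℝ (Fin d)} (hx : SuppBelow m x) (hp : Z.prob (R m) i = 0) :
    frontierPart Z m R i x = 0 := by
  have h := norm_sq_frontierPart_le (Z := Z) (R := R) (i := i) hx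
  rw [hZ.weight_eq_zero _ _ hp] at h
  have h2 : ‖frontierPart Z m R i x‖ ^ 2 = 0 := le_antisymm (by simpa using h) (sq_nonneg _)
  simpa using h2

lemma mean_gradError {σ : ℝ} (hZ : Z.IsValid σ) (m : ℕ) (R : ℕ → ℕ) (i : Fin n)
    (x : EuclideanSpace ℝ (Fin d)) :
    Z.prob (R m) i • gradError Z m R i x True +
      (1 - Z.prob (R m) i) • gradError Z m R i x False = 0 := by
  unfold gradError
  split_ifs with hx hF
  · exact hF.elim
  · by_cases hp : Z.prob (R m) i = 0
    · simp [frontierPart_eq_zero hZ hx hp]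
    · rw [smul_smul, smul_smul, ← add_smul]
      have : Z.prob (R m) i * ((Z.prob (R m) i)⁻¹ - 1) + (1 - Z.prob (R m) i) * -1 = 0 := by
        field_simp; ring
      rw [this, zero_smul]
  · simp

lemma mean_norm_sq_gradError_le {σ : ℝ} (hZ : Z.IsValid σ) (m : ℕ) (R : ℕ → ℕ) (i : Fin n)
    (x : EuclideanSpace ℝ (Fin d)) :
    Z.prob (R m) i • ‖gradError Z m R i x True‖ ^ 2 +
      (1 - Z.prob (R m) i) • ‖gradError Z m R i x False‖ ^ 2 ≤ σ ^ 2 := by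
  unfold gradError
  split_ifs with hx hF
  · exact hF.elim
  · by_cases hp : Z.prob (R m) i = 0
    · simp [frontierPart_eq_zero hZ hx hp, sq_nonneg]
    · have hpos : 0 < Z.prob (R m) i := lt_of_le_of_ne (hZ.prob_nonneg _ _) (Ne.symm hp)
      have h1 := hZ.prob_le_one (R m) i
      have h2 := norm_sq_frontierPart_le (Z := Z) (R := R) (i := i) hx
      have h3 := hZ.variance (R m) i
      rw [norm_smul, norm_smul, mul_pow, mul_pow, Real.norm_eq_abs, Real.norm_eq_abs, sq_abs,
        sq_abs]
      set q := ‖frontierPart Z m R i x‖ ^ 2 with hq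
      set p := Z.prob (R m) i with hpdef
      have h4 : p • ((p⁻¹ - 1) ^ 2 * q) + (1 - p) • ((-1) ^ 2 * q) = q * (1 - p) / p := by
        simp only [smul_eq_mul]; field_simp; ring
      rw [h4, div_le_iff₀ hpos, mul_comm (σ ^ 2)]
      exact (mul_le_mul_of_nonneg_right h2 (by linarith)).trans h3
  · simpa using sq_nonneg σ

lemma sim_hist_castLE (ω : ℕ → unitInterval) {l k : ℕ} (h : l ≤ k) :
    (fun j : Fin l => (sim Z v A ω k).1.1 (Fin.castLE h j)) = (sim Z v A ω l).1.1 := by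
  induction k, h using Nat.le_induction with
  | base => rfl
  | succ k hk ih =>
    rw [← ih]
    funext j
    have : Fin.castLE (hk.trans (Nat.le_succ k)) j = (Fin.castLE hk j).castSucc := rfl
    simp only [sim, simStep]
    rw [this, Fin.snoc_castSucc]

/-- This expresses, in a form stable under suprema of σ-algebras, that on `N` the map `φ` carries no
information beyond `S`. -/
lemma comap_le_map_of_eqOn {Ω α F : Type*} {N : Set Ω} {S : Ω → α} [mF : MeasurableSpace F]
    {φ : Ω → F} (φ' : α → F) (h : ∀ ω ∈ N, φ ω = φ' (S ω)) :
    MeasurableSpace.comap φ mF ≤ MeasurableSpace.map (Subtype.val : N → Ω)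
      (MeasurableSpace.comap (fun ω : N => S ω) ⊤) := by
  rintro _ ⟨U, -, rfl⟩
  refine ⟨φ' ⁻¹' U, trivial, ?_⟩
  ext ω
  simp [h ω.1 ω.2]

lemma condExp_le_const_of_forall_setIntegral_le {Ω : Type*} {m mΩ : MeasurableSpace Ω}
    {μ : Measure Ω} [IsFiniteMeasure μ] (hm : m ≤ mΩ) {q : Ω → ℝ} (hq : Integrable q μ) {C : ℝ}
    (h : ∀ s, MeasurableSet[m] s → ∫ ω in s, q ω ∂μ ≤ ∫ _ in s, C ∂μ) :
    μ[q | m] ≤ᵐ[μ] fun _ => C := by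
  refine ae_le_of_ae_le_trim (hm := hm) ?_
  refine ae_le_of_forall_setIntegral_le
    (integrable_condExp.trim hm stronglyMeasurable_condExp) (integrable_const C) fun s hs _ => ?_
  rw [← setIntegral_trim hm stronglyMeasurable_condExp hs,
    ← setIntegral_trim hm stronglyMeasurable_const hs, setIntegral_condExp hm hq hs]
  exact h s hs

/-- On `N`, where the query point lies in the discovered coordinates, locality turns every
conditioning gradient into a function of the current state, and the coin is independent of that
state. Off `N` the information may reveal the future, but there the error is zero. -/
lemma unbiasedBoundedVariance {σ : ℝ} (hA : IsZeroRespecting A) (hZ : Z.IsValid σ) {K : ℕ}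
    (hK : ∀ t, Z.round t ≤ K) :
    UnbiasedBoundedVariance uniformSeq v A σ (fun ω => localFun Z (finalRounds Z v A ω))
      (stochGrad Z) (randomElement Z v A) := by
  classical
  intro k i x t τ X G D
  set S : (ℕ → unitInterval) → SimState n d k := fun ω => sim Z v A ω k with hS
  have hSs : IsSimpleMap S := isSimpleMap_sim k
  have hRs : IsSimpleMap (finalRounds Z v A) := isSimpleMap_finalRounds hA hK
  have hτ : ∀ ω, τ ω = (S ω).1.1 := fun ω => transcript_eq_sim hA ω k
  have hX : ∀ ω, X ω = x (S ω).1.1 := fun ω => by simp only [X, hτ]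
  set pr : SimState n d k → ℝ := fun s => Z.prob (s.2.2 s.2.1) i with hpr
  have hfin : ∀ ω, ∀ j ≤ (S ω).2.1, finalRounds Z v A ω j = (S ω).2.2 j :=
    fun ω j hj => finalRounds_eq hA ω hj
  set err : SimState n d k → Prop → EuclideanSpace ℝ (Fin d) :=
    fun s b => gradError Z s.2.1 s.2.2 i (x s.1.1) b with herr
  have hD : ∀ ω, D ω = localGrad Z (finalRounds Z v A ω) i (x (S ω).1.1) := fun ω => by
    simp only [D, hX, gradient_localFun]
  have hGD : ∀ ω, G ω - D ω = err (S ω) ((ω k : ℝ) < pr (S ω)) := by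
    intro ω
    rw [hD]
    simp only [G, hX, stochGrad, randomElement]
    rw [noisyGrad_sub_localGrad]
    simp only [herr, hpr, gradError]
    by_cases hx : SuppBelow (S ω).2.1 (x (S ω).1.1)
    · have hfr : frontierPart Z (S ω).2.1 (finalRounds Z v A ω) i (x (S ω).1.1) =
          frontierPart Z (S ω).2.1 (S ω).2.2 i (x (S ω).1.1) := by
        unfold frontierPart
        rw [localGrad_congr i hx (hfin ω)]
      rw [if_pos hx, if_pos hx]
      have h2 := hfin ω _ le_rfl
      simp only [hS] at h2 hfr ⊢
      rw [h2, hfr]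
    · simp only [hS] at hx ⊢
      rw [if_neg hx, if_neg hx]
  set N : Set (ℕ → unitInterval) := {ω | SuppBelow (S ω).2.1 (x (S ω).1.1)} with hN
  have hcoin : IsSimpleMap fun ω : ℕ → unitInterval => (ω k : ℝ) < pr (S ω) := isSimpleMap_coin pr
  have hDs : IsSimpleMap D := by
    have := (hSs.prodMk hRs).comp fun y => localGrad Z y.2 i (x y.1.1.1)
    exact (funext hD : D = _) ▸ this
  have herrs : IsSimpleMap fun ω => G ω - D ω := by
    have := (hSs.prodMk hcoin).comp fun y => err y.1 y.2
    exact (funext hGD : (fun ω => G ω - D ω) = _) ▸ this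
  have hGs : IsSimpleMap G := by
    have := (hDs.prodMk herrs).comp fun y => y.1 + y.2
    have h2 : G = fun ω => D ω + (G ω - D ω) := by funext ω; simp
    exact h2 ▸ this
  have hsqs : IsSimpleMap fun ω => ‖G ω - D ω‖ ^ 2 := herrs.comp fun y => ‖y‖ ^ 2
  have hpast : ∀ (l : Fin (k + 1)) (j : Fin n) (ω : ℕ → unitInterval),
      gradient (localFun Z (finalRounds Z v A ω) j)
        (iterate v A (realize (stochGrad Z) (randomElement Z v A) ω) l) =
      localGrad Z (finalRounds Z v A ω) j (A l (sim Z v A ω l).1.1).point := fun l j ω => by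
    rw [gradient_localFun, iterate_eq_sim hA]
  have hGi : Integrable G uniformSeq := hGs.integrable _
  have hDi : Integrable D uniformSeq := hDs.integrable _
  have hsqi : Integrable (fun ω => ‖G ω - D ω‖ ^ 2) uniformSeq := hsqs.integrable _
  have hSi : ∀ y : SimState n d k → ℝ, Integrable (fun ω => y (S ω)) uniformSeq :=
    fun y => (hSs.comp y).integrable _
  have hcall : callInfo v A (fun ω => localFun Z (finalRounds Z v A ω)) (stochGrad Z)
      (randomElement Z v A) k X ≤ MeasurableSpace.pi := by
    refine sup_le (sup_le ?_ (iSup₂_le fun l j => ?_)) (iSup_le fun j => ?_)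
    · refine Measurable.comap_le (IsSimpleMap.measurable ?_)
      have hτs : IsSimpleMap τ := (funext hτ : τ = _) ▸ hSs.comp fun s => s.1.1
      exact hτs
    · refine Measurable.comap_le (IsSimpleMap.measurable ?_)
      simp only [hpast]
      exact ((isSimpleMap_sim (Z := Z) (v := v) (A := A) l).prodMk hRs).comp
        fun y => localGrad Z y.2 j (A l y.1.1.1).point
    · refine Measurable.comap_le (IsSimpleMap.measurable ?_)
      simp only [gradient_localFun, hX]
      exact (hSs.prodMk hRs).comp fun y => localGrad Z y.2 j (x y.1.1.1)
  intro m
  have hm : m ≤ MeasurableSpace.pi := hcall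
  have hmN : m ≤ MeasurableSpace.map (Subtype.val : N → _)
      (MeasurableSpace.comap (fun ω : N => S ω) ⊤) := by
    refine sup_le (sup_le ?_ (iSup₂_le fun l j => ?_)) (iSup_le fun j => ?_)
    · exact comap_le_map_of_eqOn (fun s => s.1.1) fun ω _ => hτ ω
    · have hl : (l : ℕ) ≤ k := Nat.lt_succ_iff.1 l.2
      refine comap_le_map_of_eqOn (fun s => localGrad Z s.2.2 j
        (A l (fun a : Fin l => s.1.1 (Fin.castLE hl a))).point) fun ω _ => ?_
      rw [hpast, sim_hist_castLE ω hl]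
      exact localGrad_congr j ((suppBelow_point hA (simInv_sim hA ω l)).mono
        (sim_rounds_of_le ω hl).1) (hfin ω)
    · refine comap_le_map_of_eqOn (fun s => localGrad Z s.2.2 j (x s.1.1)) fun ω hω => ?_
      rw [gradient_localFun, hX]
      exact localGrad_congr j hω (hfin ω)
  -- Every event of the information coincides on `N` with an event about the current state.
  have hlocal : ∀ s, MeasurableSet[m] s → ∃ B : Set (SimState n d k), ∀ ω ∈ N,
      (ω ∈ s ↔ S ω ∈ B) := by
    intro s hs
    obtain ⟨B, -, hB⟩ := hmN s hs
    exact ⟨B, fun ω hω => (Set.ext_iff.1 hB ⟨ω, hω⟩).symm⟩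
  have herr0 : ∀ ω, ω ∉ N → ∀ b, err (S ω) b = 0 := fun ω hω b => if_neg hω
  have hp0 : ∀ s, 0 ≤ pr s := fun s => hZ.prob_nonneg _ _
  have hp1 : ∀ s, pr s ≤ 1 := fun s => hZ.prob_le_one _ _
  refine ⟨hm, hGi, ?_, hsqi, ?_⟩
  · symm
    refine ae_eq_condExp_of_forall_setIntegral_eq hm hGi
      (fun s _ _ => hDi.integrableOn) (fun s hs _ => ?_) ?_
    · rw [eq_comm, ← sub_eq_zero, ← integral_sub hGi.integrableOn
        hDi.integrableOn, ← integral_indicator (hm s hs)]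
      obtain ⟨B, hB⟩ := hlocal s hs
      -- Off `N` both sides vanish, so `s` may be replaced everywhere by the event `S ∈ B`, which
      -- does not involve coin `k`.
      have h1 : ∀ ω, s.indicator (fun ω => G ω - D ω) ω =
          (fun (y : SimState n d k) b => if y ∈ B then err y b else 0) (S ω)
            ((ω k : ℝ) < pr (S ω)) := by
        intro ω
        simp only [Set.indicator, hGD]
        by_cases hω : ω ∈ N
        · simp only [hB ω hω]
        · simp [herr0 ω hω]
      refine ((integral_congr_ae (Filter.Eventually.of_forall h1)).trans
        (integral_coin (fun (y : SimState n d k) b => if y ∈ B then err y b else 0)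
          pr hp0 hp1)).trans ?_
      refine (integral_congr_ae (Filter.Eventually.of_forall fun ω => ?_)).trans (integral_zero _ _)
      have h2 := mean_gradError hZ (S ω).2.1 (S ω).2.2 i (x (S ω).1.1)
      change pr (S ω) • (if S ω ∈ B then err (S ω) True else 0) +
        (1 - pr (S ω)) • (if S ω ∈ B then err (S ω) False else 0) = 0
      by_cases hb : S ω ∈ B
      · rw [if_pos hb, if_pos hb]
        exact h2
      · rw [if_neg hb, if_neg hb]
        simp
    · have hDm : Measurable[m] D := by
        rw [measurable_iff_comap_le]
        exact le_sup_of_le_right (le_iSup_of_le i le_rfl)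
      exact hDm.stronglyMeasurable.aestronglyMeasurable
  · refine condExp_le_const_of_forall_setIntegral_le hm hsqi fun s hs => ?_
    obtain ⟨B, hB⟩ := hlocal s hs
    rw [← integral_indicator (hm s hs), ← integral_indicator (hm s hs)]
    have h1 : ∀ ω, s.indicator (fun ω => ‖G ω - D ω‖ ^ 2) ω =
        (fun (y : SimState n d k) b => if y ∈ B then ‖err y b‖ ^ 2 else 0) (S ω)
          ((ω k : ℝ) < pr (S ω)) := by
      intro ω
      simp only [Set.indicator, hGD]
      by_cases hω : ω ∈ N
      · simp only [hB ω hω]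
      · simp [herr0 ω hω]
    refine ((integral_congr_ae (Filter.Eventually.of_forall h1)).trans
      (integral_coin (fun (y : SimState n d k) b => if y ∈ B then ‖err y b‖ ^ 2 else 0)
        pr hp0 hp1)).trans_le ?_
    refine integral_mono ?_ ?_ fun ω => ?_
    · exact hSi fun y => pr y • (if y ∈ B then ‖err y True‖ ^ 2 else 0) +
        (1 - pr y) • (if y ∈ B then ‖err y False‖ ^ 2 else 0)
    · exact (integrable_const _).indicator (hm s hs)
    · have h2 := mean_norm_sq_gradError_le hZ (S ω).2.1 (S ω).2.2 i (x (S ω).1.1)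
      have hσ := sq_nonneg σ
      change pr (S ω) • (if S ω ∈ B then ‖err (S ω) True‖ ^ 2 else 0) +
        (1 - pr (S ω)) • (if S ω ∈ B then ‖err (S ω) False‖ ^ 2 else 0) ≤ _
      by_cases hω : ω ∈ N
      · by_cases hb : S ω ∈ B
        · rw [if_pos hb, if_pos hb, Set.indicator_of_mem ((hB ω hω).2 hb)]
          exact h2
        · rw [if_neg hb, if_neg hb]
          simp only [smul_zero, add_zero]
          exact Set.indicator_nonneg (fun _ _ => hσ) ω
      · simp only [herr0 ω hω, norm_zero, ne_eq, OfNat.ofNat_ne_zero, not_false_eq_true, zero_pow,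
          ite_self, smul_zero, add_zero]
        exact Set.indicator_nonneg (fun _ _ => hσ) ω

end Measurability

/-! ### Counting discoveries within a round -/

section Counting

variable {n d : ℕ} (Z : Resisting n) (v : Fin n → ℝ≥0 → ℝ≥0) (A : Algorithm n d) (tl : ℕ → ℝ≥0∞)

/-- The conditions on the rounds, which are separated by the times `tl`, needed for the counting
argument. -/
structure Resisting.IsTimed (K : ℕ) : Prop where
  mono : Monotone tl
  zero : tl 0 = 0
  finite : ∀ i (t : ℝ≥0), V (v i) t < ⊤
  round_le : ∀ t, Z.round t ≤ K
  time_round_le : ∀ t, tl (Z.round t) ≤ t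
  le_round : ∀ (r : ℕ) (t : ℝ≥0), r ≤ K → tl r ≤ t → r ≤ Z.round t
  sum_prob_le : ∀ r cnt, FeasibleCount v (tl r) (tl (r + 1)) cnt →
    ∑ i, Z.prob r i * cnt i ≤ 1 / 4

/-- The query completes, within the round in which the current link became active, a computation
whose result can discover a coordinate. -/
def Useful {k : ℕ} (S : SimState n d k) : Prop :=
  (A k S.1.1).cancel = false ∧ (S.1.2 (A k S.1.1).worker).busy = true ∧
    1 ≤ V (v (A k S.1.1).worker) (A k S.1.1).time -
        V (v (A k S.1.1).worker) (S.1.2 (A k S.1.1).worker).time ∧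
    chainVar Z.lam (S.1.2 (A k S.1.1).worker).point S.2.1 ≠ 0 ∧
    ((A k S.1.1).time : ℝ≥0∞) < tl (S.2.2 S.2.1 + 1)

/-- The probability of a discovery in the round in which the current link became active. -/
def hazard {k : ℕ} (S : SimState n d k) : ℝ :=
  open scoped Classical in if Useful Z v A tl S then coinProb Z A S else 0

/-- The indicator of a discovery in the round in which the current link became active. -/
def early {k : ℕ} (S : SimState n d k) (b : Prop) : ℝ :=
  open scoped Classical in
  if Discovers Z v A S b ∧ ((A k S.1.1).time : ℝ≥0∞) < tl (S.2.2 S.2.1 + 1) then 1 else 0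

/-- Worker `i` completed `cnt i` useful computations since the current link became active, the
last one at time `last i`, and `Q` is the sum of the hazards so far. -/
structure CountInv {k : ℕ} (S : SimState n d k) (τ : ℝ≥0) (Q : ℝ) (cnt : Fin n → ℕ)
    (last : Fin n → ℝ≥0) : Prop where
  budget : Q ≤ S.2.1 / 4 + ∑ i, Z.prob (S.2.2 S.2.1) i * cnt i
  last_le : ∀ i, last i ≤ τ
  le_last : ∀ i, tl (S.2.2 S.2.1) ≤ last i
  work : ∀ i, (cnt i : ℝ≥0∞) ≤ V (v i) (last i) - V (v i) (tl (S.2.2 S.2.1))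
  last_lt : ∀ i, cnt i ≠ 0 → (last i : ℝ≥0∞) < tl (S.2.2 S.2.1 + 1)
  busy : ∀ i, (S.1.2 i).busy = true → chainVar Z.lam (S.1.2 i).point S.2.1 ≠ 0 →
    last i ≤ (S.1.2 i).time

/-- The times of the simulated protocol. -/
def simTime (ω : ℕ → unitInterval) : ℕ → ℝ≥0
  | 0 => 0
  | k + 1 => (A k (sim Z v A ω k).1.1).time

/-- The number of discoveries before iteration `N` in the round in which the current link became
active. -/
def earlyCount (ω : ℕ → unitInterval) (N : ℕ) : ℝ :=
  ∑ l ∈ Finset.range N, early Z v A tl (sim Z v A ω l) ((ω l : ℝ) < coinProb Z A (sim Z v A ω l))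

variable {Z v A tl} {K : ℕ}

lemma iterTime_eq_simTime (hA : IsZeroRespecting A) (ω : ℕ → unitInterval) (k : ℕ) :
    iterTime v A (realize (stochGrad Z) (randomElement Z v A) ω) k = simTime Z v A ω k := by
  cases k with
  | zero => rfl
  | succ k => rw [iterTime, transcript_eq_sim hA, simTime]

lemma simTime_le_succ (hA : IsZeroRespecting A) (ω : ℕ → unitInterval) (k : ℕ) :
    simTime Z v A ω k ≤ simTime Z v A ω (k + 1) := by
  cases k with
  | zero => exact zero_le
  | succ k =>
    have h := hA.time_mono k (sim Z v A ω (k + 1)).1.1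
    have h2 : Fin.init (sim Z v A ω (k + 1)).1.1 = (sim Z v A ω k).1.1 := by
      simp [sim, simStep, Fin.init_snoc]
    rw [h2] at h
    exact h

lemma Discovers.completes {k : ℕ} {S : SimState n d k} (hS : SimInv S) {b : Prop}
    (h : Discovers Z v A S b) : b ∧ (A k S.1.1).cancel = false ∧
      (S.1.2 (A k S.1.1).worker).busy = true ∧
      1 ≤ V (v (A k S.1.1).worker) (A k S.1.1).time -
        V (v (A k S.1.1).worker) (S.1.2 (A k S.1.1).worker).time ∧
      chainVar Z.lam (S.1.2 (A k S.1.1).worker).point S.2.1 ≠ 0 := by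
  obtain ⟨c, hc, hne⟩ := h
  rcases simAnswer_snd_eq (Z := Z) (v := v) (A := A) S b with h0 | ⟨h1, h2, h3, h4⟩
  · rw [h0] at hne; exact absurd rfl hne
  · rw [h1] at hne
    obtain ⟨hb, hx⟩ := of_noisyGrad_apply_ne_zero (hS.state _) hc hne
    exact ⟨hb, h2, h3, h4, hx⟩

lemma simAnswer_fst_of_completes {k : ℕ} {S : SimState n d k} {b : Prop}
    (h : (A k S.1.1).cancel = false ∧ (S.1.2 (A k S.1.1).worker).busy = true ∧
      1 ≤ V (v (A k S.1.1).worker) (A k S.1.1).time -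
        V (v (A k S.1.1).worker) (S.1.2 (A k S.1.1).worker).time) :
    (simAnswer Z v A S b).1 = idle d := by
  unfold simAnswer oracle
  rw [if_neg (by simp [h.1]), if_neg (by simp [h.2.1]), if_neg (not_lt.2 h.2.2)]

/-- A failed coin discovers nothing, and an early discovery presupposes a useful query. So the
conditional probability of an early discovery is at most the hazard. -/
lemma early_le {k : ℕ} {S : SimState n d k} (hS : SimInv S) (hp : 0 ≤ coinProb Z A S) :
    coinProb Z A S • early Z v A tl S True + (1 - coinProb Z A S) • early Z v A tl S False ≤
      hazard Z v A tl S := by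
  have hF : early Z v A tl S False = 0 := if_neg fun h => (h.1.completes hS).1
  rw [hF, smul_zero, add_zero]
  unfold hazard early
  split_ifs with h1 h2 h2
  · simp
  · exact absurd ⟨(h1.1.completes hS).2.1, (h1.1.completes hS).2.2.1, (h1.1.completes hS).2.2.2.1,
      (h1.1.completes hS).2.2.2.2, h1.2⟩ h2
  · simpa using hp
  · simp

lemma CountInv.sum_le {k : ℕ} {S : SimState n d k} {τ : ℝ≥0} {Q : ℝ} {cnt : Fin n → ℕ}
    {last : Fin n → ℝ≥0} (hT : Z.IsTimed v tl K) (h : CountInv Z v tl S τ Q cnt last) :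
    Q ≤ S.2.1 / 4 + 1 / 4 := by
  have := hT.sum_prob_le (S.2.2 S.2.1) cnt fun i hi => ⟨last i, h.last_lt i hi, h.work i⟩
  linarith [h.budget]

/-- This treats the change of the oracle state only, not of the discovered coordinates. A useful
query increases the count of its worker by one, which pays exactly for the hazard; any other query
has hazard `0`. -/
lemma CountInv.answer {k : ℕ} {S : SimState n d k} {τ : ℝ≥0} {Q : ℝ} {cnt : Fin n → ℕ}
    {last : Fin n → ℝ≥0} (hT : Z.IsTimed v tl K) (h : CountInv Z v tl S τ Q cnt last)
    (hτ : τ ≤ (A k S.1.1).time) (b : Prop) :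
    ∃ cnt' last', CountInv Z v tl
      ((S.1.1, Function.update S.1.2 (A k S.1.1).worker (simAnswer Z v A S b).1), S.2)
      (A k S.1.1).time (Q + hazard Z v A tl S) cnt' last' := by
  classical
  set i := (A k S.1.1).worker with hi
  set t := (A k S.1.1).time with ht
  by_cases hU : Useful Z v A tl S
  · obtain ⟨h1, h2, h3, h4, h5⟩ := hU
    refine ⟨fun j => cnt j + if j = i then 1 else 0, Function.update last i t, ?_, ?_, ?_, ?_,
      ?_, ?_⟩
    · have hs : ∑ j, Z.prob (S.2.2 S.2.1) j * ((cnt j + if j = i then 1 else 0 : ℕ) : ℝ) =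
          ∑ j, Z.prob (S.2.2 S.2.1) j * cnt j + coinProb Z A S := by
        simp [mul_add, Finset.sum_add_distrib, coinProb, hi]
      simp only
      rw [hs, hazard, if_pos ⟨h1, h2, h3, h4, h5⟩]
      linarith [h.budget]
    · intro j
      by_cases hj : j = i
      · subst hj; simp
      · simpa [hj] using (h.last_le j).trans hτ
    · intro j
      by_cases hj : j = i
      · rw [hj]
        simpa using (h.le_last i).trans (ENNReal.coe_le_coe.2 ((h.last_le i).trans hτ))
      · simpa [hj] using h.le_last j
    · intro j
      by_cases hj : j = i
      · subst hj
        simp only [if_true, Function.update_self, Nat.cast_add, Nat.cast_one]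
        -- The finished computation started no earlier than the last counted one ended, so their
        -- work adds up to at least one more unit.
        have hb := h.busy _ h2 h4
        have hVb := V_mono (v (A k S.1.1).worker) (ENNReal.coe_le_coe.2 hb)
        have hfin : V (v (A k S.1.1).worker) (S.1.2 (A k S.1.1).worker).time ≠ ⊤ :=
          (hT.finite _ _).ne
        have h6 : V (v (A k S.1.1).worker) (S.1.2 (A k S.1.1).worker).time + 1 ≤
            V (v (A k S.1.1).worker) t := by
          have h7 : V (v (A k S.1.1).worker) (S.1.2 (A k S.1.1).worker).time ≤
              V (v (A k S.1.1).worker) t := by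
            by_contra hlt
            rw [tsub_eq_zero_of_le (not_le.1 hlt).le] at h3
            exact absurd h3 (by simp)
          calc _ ≤ V (v (A k S.1.1).worker) (S.1.2 (A k S.1.1).worker).time +
                (V (v (A k S.1.1).worker) t -
                  V (v (A k S.1.1).worker) (S.1.2 (A k S.1.1).worker).time) := by gcongr
            _ = _ := add_tsub_cancel_of_le h7
        have hR := V_mono (v (A k S.1.1).worker) (h.le_last (A k S.1.1).worker)
        have hRfin : V (v (A k S.1.1).worker) (tl (S.2.2 S.2.1)) ≠ ⊤ :=
          (hR.trans_lt (hT.finite _ _)).ne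
        refine ENNReal.le_sub_of_add_le_right hRfin ?_
        calc (cnt (A k S.1.1).worker : ℝ≥0∞) + 1 + V (v (A k S.1.1).worker) (tl (S.2.2 S.2.1))
            ≤ (V (v (A k S.1.1).worker) (last (A k S.1.1).worker) -
              V (v (A k S.1.1).worker) (tl (S.2.2 S.2.1))) + 1 +
              V (v (A k S.1.1).worker) (tl (S.2.2 S.2.1)) := by
              gcongr; exact h.work _
          _ = V (v (A k S.1.1).worker) (last (A k S.1.1).worker) + 1 := by
              rw [add_right_comm, tsub_add_cancel_of_le hR]
          _ ≤ V (v (A k S.1.1).worker) (S.1.2 (A k S.1.1).worker).time + 1 := by gcongr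
          _ ≤ _ := h6
      · simpa [hj] using h.work j
    · intro j
      by_cases hj : j = i
      · subst hj; simpa using h5
      · simpa [hj] using h.last_lt j
    · intro j
      by_cases hj : j = i
      · subst hj
        simp [simAnswer_fst_of_completes (Z := Z) (b := b) ⟨h1, h2, h3⟩, idle]
      · simpa [hj] using h.busy j
  · refine ⟨cnt, last, ?_, fun j => (h.last_le j).trans hτ, h.le_last, h.work, h.last_lt, ?_⟩
    · rw [hazard, if_neg hU, add_zero]
      exact h.budget
    · intro j
      by_cases hj : j = i
      · subst hj
        simp only [Function.update_self]
        unfold simAnswer oracle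
        split_ifs
        · simp [idle]
        · intro _ _; exact (h.last_le _).trans hτ
        · exact h.busy _
        · simp [idle]
      · simpa [hj] using h.busy j

/-- On a discovery the counts are reset. The hazards spent on the old link are at most `1/4`,
absorbed by `m` growing by one. No stored point uses the new variable yet, so computations already
running cannot become useful. -/
lemma CountInv.step {k : ℕ} {S : SimState n d k} (hS : SimInv S) {τ : ℝ≥0} {Q : ℝ}
    {cnt : Fin n → ℕ} {last : Fin n → ℝ≥0} (hT : Z.IsTimed v tl K)
    (h : CountInv Z v tl S τ Q cnt last) (hτ : τ ≤ (A k S.1.1).time) (b : Prop) :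
    ∃ cnt' last', CountInv Z v tl (simStep Z v A S b) (A k S.1.1).time
      (Q + hazard Z v A tl S) cnt' last' := by
  classical
  obtain ⟨cnt', last', h'⟩ := h.answer (A := A) hT hτ b
  by_cases hd : Discovers Z v A S b
  · have hsum := h'.sum_le hT
    refine ⟨fun _ => 0, fun _ => (A k S.1.1).time, ?_, fun _ => le_rfl, fun _ => ?_, fun _ => ?_,
      fun _ h0 => absurd rfl h0, fun j hj hx => absurd ?_ hx⟩
    · simp only [simStep, hd, if_true] at hsum ⊢
      push_cast
      simp only [mul_zero, Finset.sum_const_zero, add_zero]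
      linarith
    · simpa [simStep, hd] using hT.time_round_le _
    · simp
    · simp only [simStep, hd, if_true] at hj ⊢
      by_cases hji : j = (A k S.1.1).worker
      · obtain ⟨-, h1, h2, h3, -⟩ := hd.completes hS
        subst hji
        simp [simAnswer_fst_of_completes (Z := Z) (b := b) ⟨h1, h2, h3⟩, idle] at hj
      · rw [Function.update_of_ne hji]
        exact (hS.state j).chainVar_eq_zero (Nat.lt_succ_self _)
  · refine ⟨cnt', last', ?_, h'.last_le, ?_, ?_, ?_, ?_⟩
    · simpa [simStep, hd] using h'.budget
    · simpa [simStep, hd] using h'.le_last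
    · simpa [simStep, hd] using h'.work
    · simpa [simStep, hd] using h'.last_lt
    · simpa [simStep, hd] using h'.busy

lemma exists_countInv (hA : IsZeroRespecting A) (hT : Z.IsTimed v tl K) (ω : ℕ → unitInterval)
    (k : ℕ) :
    ∃ cnt last, CountInv Z v tl (sim Z v A ω k) (simTime Z v A ω k)
      (∑ l ∈ Finset.range k, hazard Z v A tl (sim Z v A ω l)) cnt last := by
  induction k with
  | zero =>
    refine ⟨fun _ => 0, fun _ => 0, ?_, fun _ => le_rfl, ?_, ?_, ?_, ?_⟩
    · simp [sim]
    · simp [sim, hT.zero]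
    · simp
    · simp
    · simp
  | succ k ih =>
    obtain ⟨cnt, last, h⟩ := ih
    rw [Finset.sum_range_succ]
    exact h.step (simInv_sim hA ω k) hT (simTime_le_succ hA ω k) _

lemma sum_hazard_le (hA : IsZeroRespecting A) (hT : Z.IsTimed v tl K) (ω : ℕ → unitInterval)
    (N : ℕ) : ∑ l ∈ Finset.range N, hazard Z v A tl (sim Z v A ω l) ≤ (d + 1) / 4 := by
  obtain ⟨cnt, last, h⟩ := exists_countInv hA hT ω N
  have h1 := h.sum_le hT
  have h2 : ((sim Z v A ω N).2.1 : ℝ) ≤ d := by exact_mod_cast (simInv_sim hA ω N).le_dim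
  linarith

lemma isSimpleMap_early (l : ℕ) : IsSimpleMap fun ω => early Z v A tl (sim Z v A ω l)
    ((ω l : ℝ) < coinProb Z A (sim Z v A ω l)) :=
  ((isSimpleMap_sim l).prodMk (isSimpleMap_coin (coinProb Z A))).comp
    fun y => early Z v A tl y.1 y.2

/-- In expectation each indicator of an early discovery is dominated by its hazard, and the sum of
the hazards is bounded for every outcome. -/
lemma integral_earlyCount_le {σ : ℝ} (hA : IsZeroRespecting A) (hZ : Z.IsValid σ)
    (hT : Z.IsTimed v tl K) (N : ℕ) :
    ∫ ω, earlyCount Z v A tl ω N ∂uniformSeq ≤ (d + 1) / 4 := by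
  have hi : ∀ l, Integrable (fun ω => hazard Z v A tl (sim Z v A ω l)) uniformSeq := fun l =>
    ((isSimpleMap_sim l).comp _).integrable _
  unfold earlyCount
  rw [integral_finsetSum _ fun l _ => (isSimpleMap_early l).integrable _]
  calc _ ≤ ∑ l ∈ Finset.range N, ∫ ω, hazard Z v A tl (sim Z v A ω l) ∂uniformSeq := by
        refine Finset.sum_le_sum fun l _ => ?_
        rw [integral_coin (early Z v A tl) (coinProb Z A) (fun _ => hZ.prob_nonneg _ _)
          fun _ => hZ.prob_le_one _ _]
        refine integral_mono ?_ (hi l) fun ω => early_le (simInv_sim hA ω l)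
          (hZ.prob_nonneg _ _)
        exact ((isSimpleMap_sim l).comp fun S => coinProb Z A S • early Z v A tl S True +
          (1 - coinProb Z A S) • early Z v A tl S False).integrable _
    _ = ∫ ω, ∑ l ∈ Finset.range N, hazard Z v A tl (sim Z v A ω l) ∂uniformSeq :=
        (integral_finsetSum _ fun l _ => hi l).symm
    _ ≤ ∫ _, ((d : ℝ) + 1) / 4 ∂uniformSeq :=
        integral_mono (integrable_finsetSum _ fun l _ => hi l) (integrable_const _)
          fun ω => sum_hazard_le hA hT ω N
    _ = _ := by simp

lemma early_nonneg {k : ℕ} (S : SimState n d k) (b : Prop) : 0 ≤ early Z v A tl S b := by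
  unfold early
  split_ifs <;> norm_num

lemma earlyCount_mono (ω : ℕ → unitInterval) : Monotone (earlyCount Z v A tl ω) :=
  fun _ _ h => Finset.sum_le_sum_of_subset_of_nonneg (Finset.range_subset_range.2 h)
    fun _ _ _ => early_nonneg _ _

/-- An early discovery is counted and does not lower the round; any other discovery raises the round
of the current link by at least one. -/
lemma progress_le (hA : IsZeroRespecting A) (hT : Z.IsTimed v tl K) (ω : ℕ → unitInterval)
    (k : ℕ) (hk : (simTime Z v A ω k : ℝ≥0∞) < tl K) :
    ((sim Z v A ω k).2.1 : ℝ) ≤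
      earlyCount Z v A tl ω k + ((sim Z v A ω k).2.2 (sim Z v A ω k).2.1 : ℕ) := by
  classical
  induction k with
  | zero => simp [sim, earlyCount]
  | succ k ih =>
    have hτ := simTime_le_succ (Z := Z) (v := v) hA ω k
    have ih := ih ((ENNReal.coe_le_coe.2 hτ).trans_lt hk)
    obtain ⟨cnt, last, hc⟩ := exists_countInv hA hT ω k
    rw [earlyCount, Finset.sum_range_succ, ← earlyCount]
    set S := sim Z v A ω k with hS
    set b : Prop := (ω k : ℝ) < coinProb Z A S with hb
    have hsim : sim Z v A ω (k + 1) = simStep Z v A S b := rfl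
    have ht : simTime Z v A ω (k + 1) = (A k S.1.1).time := rfl
    rw [ht] at hτ hk
    rw [hsim]
    by_cases hd : Discovers Z v A S b
    · simp only [simStep, hd, if_true, Function.update_self]
      push_cast
      by_cases hr : ((A k S.1.1).time : ℝ≥0∞) < tl (S.2.2 S.2.1 + 1)
      · have he : early Z v A tl S b = 1 := if_pos ⟨hd, hr⟩
        have hle : S.2.2 S.2.1 ≤ Z.round (A k S.1.1).time := by
          refine hT.le_round _ _ (sim_rounds_le hT.round_le ω k _) ?_
          by_cases hn : Nonempty (Fin n)
          · obtain ⟨i⟩ := hn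
            exact (hc.le_last i).trans (ENNReal.coe_le_coe.2 ((hc.last_le i).trans hτ))
          · exact absurd ⟨(A k S.1.1).worker⟩ hn
        have hle' : ((S.2.2 S.2.1 : ℕ) : ℝ) ≤ Z.round (A k S.1.1).time := by exact_mod_cast hle
        rw [he]
        linarith
      · have hle : S.2.2 S.2.1 + 1 ≤ Z.round (A k S.1.1).time := by
          refine hT.le_round _ _ ?_ (not_lt.1 hr)
          -- The time is still before `tl K`, so the next round has index at most `K` and the cap in
          -- `round` does no harm.
          by_contra hlt
          exact absurd ((hT.mono (not_le.1 hlt).le).trans (not_lt.1 hr)) (not_le.2 hk)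
        have hle' : ((S.2.2 S.2.1 : ℕ) : ℝ) + 1 ≤ Z.round (A k S.1.1).time := by
          exact_mod_cast hle
        have h0 := early_nonneg (Z := Z) (v := v) (A := A) (tl := tl) S b
        linarith
    · simp only [simStep, hd, if_false]
      have h0 := early_nonneg (Z := Z) (v := v) (A := A) (tl := tl) S b
      linarith

/-- Before `tl K` the round of the current link is at most `K - 1`, which leaves at least `2K - (K -
1)` early discoveries. -/
lemma lt_earlyCount (hA : IsZeroRespecting A) (hT : Z.IsTimed v tl K) (ω : ℕ → unitInterval)
    (k : ℕ) (hk : (simTime Z v A ω k : ℝ≥0∞) < tl K) (hd : d = 2 * K)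
    (hm : d ≤ (sim Z v A ω k).2.1) : (K : ℝ) + 1 ≤ earlyCount Z v A tl ω k := by
  have h := progress_le hA hT ω k hk
  obtain ⟨cnt, last, hc⟩ := exists_countInv hA hT ω k
  have hlt : (sim Z v A ω k).2.2 (sim Z v A ω k).2.1 < K := by
    by_contra hge
    have i := (A k (sim Z v A ω k).1.1).worker
    have h1 := (hT.mono (not_lt.1 hge)).trans
      ((hc.le_last i).trans (ENNReal.coe_le_coe.2 (hc.last_le i)))
    exact absurd h1 (not_le.2 hk)
  have h1 : (((sim Z v A ω k).2.2 (sim Z v A ω k).2.1 : ℕ) : ℝ) + 1 ≤ K := by exact_mod_cast hlt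
  have h2 : (2 : ℝ) * K ≤ (sim Z v A ω k).2.1 := by
    exact_mod_cast hd.symm.le.trans hm
  linarith

/-- With probability at least `1/2`, some coordinate remains undiscovered before time `tl K`. -/
lemma exists_undiscovered {σ : ℝ} (hA : IsZeroRespecting A) (hZ : Z.IsValid σ)
    (hT : Z.IsTimed v tl K) (hd : d = 2 * K) :
    ∃ E : Set (ℕ → unitInterval), MeasurableSet E ∧ 1 / 2 ≤ uniformSeq E ∧
      ∀ ω ∈ E, ∀ k, (simTime Z v A ω k : ℝ≥0∞) < tl K → (sim Z v A ω k).2.1 < d := by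
  set B : ℕ → Set (ℕ → unitInterval) := fun N => {ω | (K : ℝ) + 1 ≤ earlyCount Z v A tl ω N}
    with hB
  have hmeas : ∀ N, Measurable fun ω => earlyCount Z v A tl ω N := fun N =>
    Finset.measurable_sum _ fun l _ => (isSimpleMap_early l).measurable
  have hint : ∀ N, Integrable (fun ω => earlyCount Z v A tl ω N) uniformSeq := fun N =>
    integrable_finsetSum _ fun l _ => (isSimpleMap_early l).integrable _
  have hBm : ∀ N, MeasurableSet (B N) := fun N => measurableSet_le measurable_const (hmeas N)
  have hBmono : Monotone B := fun _ _ h ω hω => le_trans hω (earlyCount_mono ω h)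
  have hBle : ∀ N, uniformSeq (B N) ≤ 1 / 2 := by
    intro N
    have h1 := mul_meas_ge_le_integral_of_nonneg (μ := uniformSeq)
      (Filter.Eventually.of_forall fun ω =>
        (Finset.sum_nonneg fun l _ => early_nonneg _ _ : 0 ≤ earlyCount Z v A tl ω N))
      (hint N) ((K : ℝ) + 1)
    have h2 := h1.trans (integral_earlyCount_le hA hZ hT N)
    have hK : (0 : ℝ) < K + 1 := by positivity
    have hdK : (d : ℝ) = 2 * K := by exact_mod_cast hd
    -- Markov's inequality, with mean at most `(2K + 1) / 4 ≤ (K + 1) / 2`.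
    have h3 : uniformSeq.real (B N) ≤ 1 / 2 := by
      rw [← mul_le_mul_iff_right₀ hK]
      refine h2.trans ?_
      linarith
    rw [measureReal_def] at h3
    have h4 := (ENNReal.le_ofReal_iff_toReal_le (measure_ne_top _ _) (by norm_num)).2 h3
    refine h4.trans_eq ?_
    rw [ENNReal.ofReal_div_of_pos (by norm_num)]
    simp
  -- The events increase with `N`, so the bound holds for all iterations simultaneously, even if
  -- infinitely many precede `tl K`.
  have hU : uniformSeq (⋃ N, B N) ≤ 1 / 2 := by
    rw [hBmono.measure_iUnion]
    exact iSup_le hBle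
  refine ⟨(⋃ N, B N)ᶜ, (MeasurableSet.iUnion hBm).compl, ?_, fun ω hω k hk => ?_⟩
  · rw [prob_compl_eq_one_sub (MeasurableSet.iUnion hBm)]
    refine le_trans ?_ (tsub_le_tsub_left hU 1)
    rw [ENNReal.sub_half ENNReal.one_ne_top]
  · by_contra hge
    exact hω (Set.mem_iUnion.2 ⟨k, lt_earlyCount hA hT ω k hk hd (not_lt.1 hge)⟩)

end Counting

/-! ### Assembly of the lower bound. -/

/-- Since the weights of each round sum to one, the random activation rounds cancel from the
average: the objective is deterministic. -/
lemma average_localFun {n d : ℕ} (hn : 0 < n) {Z : Resisting n} (hw : ∀ r, ∑ i, Z.weight r i = 1)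
    (R : ℕ → ℕ) :
    average (localFun (d := d) Z R) = chainFun Z.scale Z.lam fun _ => 1 := by
  funext x
  have hn' : (n : ℝ) ≠ 0 := by exact_mod_cast hn.ne'
  simp only [average, localFun, chainFun]
  rw [← Finset.mul_sum, Finset.sum_comm, mul_left_comm, Finset.mul_sum]
  congr 1
  refine Finset.sum_congr rfl fun j _ => ?_
  rw [← Finset.sum_mul, ← Finset.mul_sum, hw, mul_one, ← mul_assoc, inv_mul_cancel₀ hn']

/-- The number of the round before `K + 1` in which a time lies. -/
def roundOf (tl : ℕ → ℝ≥0∞) (K : ℕ) (t : ℝ≥0) : ℕ :=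
  open scoped Classical in Nat.findGreatest (fun r => tl r ≤ t) K

/-- On an event of probability at least `1/2` the squared gradient norm is at least `(8√ε / 4)^2 =
4ε` at every admissible iterate. -/
lemma lowerBound_of_profile {n d K : ℕ} (hn : 0 < n) {v : Fin n → ℝ≥0 → ℝ≥0} {A : Algorithm n d}
    (hA : IsZeroRespecting A) {Z : Resisting n} {tl : ℕ → ℝ≥0∞} {σ ε : ℝ} (hε : 0 < ε)
    (hZ : Z.IsValid σ) (hT : Z.IsTimed v tl K) (hw : ∀ r, ∑ i, Z.weight r i = 1)
    (hd : d = 2 * K) (hpos : 0 < tl K) (hscale : 0 ≤ Z.scale) (hlam : 0 < Z.lam)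
    (hgrad : Z.scale * Z.lam⁻¹ = 8 * √ε) :
    ENNReal.ofReal ε < ∫⁻ ω, ⨅ (k : ℕ)
      (_ : (iterTime v A (realize (stochGrad Z) (randomElement Z v A) ω) k : ℝ≥0∞) ≤ tl K / 2),
        ‖gradient (average (localFun Z (finalRounds Z v A ω)))
          (iterate v A (realize (stochGrad Z) (randomElement Z v A) ω) k)‖ₑ ^ 2 ∂uniformSeq := by
  obtain ⟨E, hE, hPE, hgood⟩ := exists_undiscovered hA hZ hT hd
  have hlow : ∀ ω ∈ E, ENNReal.ofReal (4 * ε) ≤ ⨅ (k : ℕ)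
      (_ : (iterTime v A (realize (stochGrad Z) (randomElement Z v A) ω) k : ℝ≥0∞) ≤ tl K / 2),
        ‖gradient (average (localFun Z (finalRounds Z v A ω)))
          (iterate v A (realize (stochGrad Z) (randomElement Z v A) ω) k)‖ₑ ^ 2 := by
    intro ω hω
    refine le_iInf₂ fun k hk => ?_
    rw [iterTime_eq_simTime hA] at hk
    have hlt : (simTime Z v A ω k : ℝ≥0∞) < tl K := by
      by_cases htop : tl K = ⊤
      · rw [htop]; exact ENNReal.coe_lt_top
      · exact hk.trans_lt (ENNReal.half_lt_self hpos.ne' htop)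
    have hm := hgood ω hω k hlt
    have hx := suppBelow_point hA (simInv_sim (Z := Z) (v := v) hA ω k)
    rw [average_localFun hn hw, gradient_chainFun, iterate_eq_sim hA]
    have hnorm := le_norm_chainGrad_one hscale hlam (A k (sim Z v A ω k).1.1).point
      (by rw [hx.chainVar_eq_zero hm]; exact zero_lt_one)
    rw [hgrad] at hnorm
    have hsq : 4 * ε ≤
        ‖chainGrad Z.scale Z.lam (fun _ => 1) (A k (sim Z v A ω k).1.1).point‖ ^ 2 := by
      have h1 := pow_le_pow_left₀ (by positivity) hnorm 2
      have h2 : (8 * √ε / 4) ^ 2 = 4 * ε := by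
        rw [div_pow, mul_pow, Real.sq_sqrt hε.le]; ring
      rwa [h2] at h1
    refine (ENNReal.ofReal_le_ofReal hsq).trans_eq ?_
    rw [ENNReal.ofReal_pow (norm_nonneg _), ofReal_norm]
  calc ENNReal.ofReal ε < ENNReal.ofReal (4 * ε) * (1 / 2) := by
        have h : ENNReal.ofReal (4 * ε) * (1 / 2) = ENNReal.ofReal (2 * ε) := by
          have h2 : (1 / 2 : ℝ≥0∞) = ENNReal.ofReal (1 / 2) := by
            rw [ENNReal.ofReal_div_of_pos (by norm_num)]; simp
          rw [h2, ← ENNReal.ofReal_mul (by positivity)]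
          congr 1
          ring
        rw [h]
        exact (ENNReal.ofReal_lt_ofReal_iff (by positivity)).2 (by linarith)
    _ ≤ ENNReal.ofReal (4 * ε) * uniformSeq E := by gcongr
    _ = ∫⁻ _ in E, ENNReal.ofReal (4 * ε) ∂uniformSeq := by rw [setLIntegral_const]
    _ = ∫⁻ ω, E.indicator (fun _ => ENNReal.ofReal (4 * ε)) ω ∂uniformSeq :=
        (lintegral_indicator hE _).symm
    _ ≤ _ := lintegral_mono fun ω => by
        by_cases hω : ω ∈ E
        · rw [Set.indicator_of_mem hω]; exact hlow ω hω
        · rw [Set.indicator_of_notMem hω]; exact zero_le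

end TimeOracle

end

open TimeOracle in
theorem theorem6 :
    ∃ c' c₁ c₂ c₃ : ℝ, 0 < c' ∧ 0 < c₁ ∧ 0 < c₂ ∧ 0 < c₃ ∧
      ∀ (n : ℕ) (_ : 0 < n) (v : Fin n → ℝ≥0 → ℝ≥0) (_ : ∀ i, IsComputationPower (v i))
        (L Δ ε σ : ℝ) (_ : 0 < L) (_ : 0 < Δ) (_ : 0 < ε) (_ : 0 ≤ σ) (_ : ε < c' * (L * Δ)),
      ∃ d : ℕ, ∀ A : Algorithm n d, IsZeroRespecting A →
        ∃ (Ω Ξ : Type) (_ : MeasurableSpace Ω) (_ : MeasurableSpace Ξ)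
          (P : Measure Ω) (_ : IsProbabilityMeasure P)
          (f : Ω → Fin n → EuclideanSpace ℝ (Fin d) → ℝ)
          (g : Fin n → EuclideanSpace ℝ (Fin d) → Ξ → ℝ≥0 → EuclideanSpace ℝ (Fin d))
          (ξ : ℕ → Ω → Ξ),
          (∀ i x, Measurable fun ω => f ω i x) ∧
          (∀ k, Measurable (ξ k)) ∧
          (∀ ω i, Differentiable ℝ (f ω i)) ∧
          (∀ ω, IsAdmissible L Δ (average (f ω))) ∧
          UnbiasedBoundedVariance P v A σ f g ξ ∧
          ENNReal.ofReal ε <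
            ∫⁻ ω, ⨅ (k : ℕ) (_ : (iterTime v A (realize g ξ ω) k : ℝ≥0∞) ≤
                lowerTime v c₂ c₃ σ ε ⌊c₁ * (L * Δ / ε)⌋₊ / 2),
              ‖gradient (average (f ω)) (iterate v A (realize g ξ ω) k)‖ₑ ^ 2 ∂P := by
  classical
  -- `c' = c₁` gives `K ≥ 1`. The value `c₃ = 1` matches the unit of work after which the oracle
  -- answers.
  refine ⟨1 / 23040, 1 / 23040, 1 / 256, 1, by norm_num, by norm_num, by norm_num, by norm_num, ?_⟩
  intro n hn v hv L Δ ε σ hL hΔ hε hσ hlt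
  set K := ⌊1 / 23040 * (L * Δ / ε)⌋₊ with hK
  have hK1 : 1 ≤ K := by
    refine Nat.le_floor ?_
    rw [Nat.cast_one, ← mul_div_assoc, le_div_iff₀ hε, one_mul]
    exact hlt.le
  have hKle : (K : ℝ) ≤ 1 / 23040 * (L * Δ / ε) := Nat.floor_le (by positivity)
  refine ⟨2 * K, fun A hA => ?_⟩
  set tl := lowerTime v (1 / 256) 1 σ ε with htl
  choose w p hprof using fun r => exists_isProfile hn hv hε hσ r
  have hsq : √ε ^ 2 = ε := Real.sq_sqrt hε.le
  have hsε : 0 < √ε := Real.sqrt_pos.2 hε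
  -- The scaling solves `scale / lam = 8√ε` and `30 * scale / lam^2 = L`. Then `scale * 4 * (2K + 1)
  -- ≤ 12 * scale * K ≤ Δ` holds because `1920 * 12 = 23040`.
  let Z : Resisting n :=
    { scale := 1920 * ε / L
      lam := 240 * √ε / L
      weight := w
      prob := p
      round := roundOf tl K }
  have hscale : 0 ≤ Z.scale := by positivity
  have hlam : 0 < Z.lam := by positivity
  have hgrad : Z.scale * Z.lam⁻¹ = 8 * √ε := by
    change 1920 * ε / L * (240 * √ε / L)⁻¹ = 8 * √ε
    field_simp
    rw [hsq]
    ring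
  have hZ : Z.IsValid σ :=
    { prob_nonneg := fun r => (hprof r).prob_nonneg
      prob_le_one := fun r => (hprof r).prob_le_one
      weight_eq_zero := fun r => (hprof r).weight_eq_zero
      variance := fun r i => by rw [hgrad]; exact (hprof r).variance i }
  have hT : Z.IsTimed v tl K :=
    { mono := lowerTime_mono hn
      zero := by simp [htl, lowerTime]
      finite := fun i t => (hv i).finite t
      round_le := fun t => Nat.findGreatest_le K
      time_round_le := fun t => Nat.findGreatest_spec (P := fun r => tl r ≤ t) (Nat.zero_le K)
        (by simp [htl, lowerTime])
      le_round := fun r t hr h => Nat.le_findGreatest hr h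
      sum_prob_le := fun r => (hprof r).sum_prob_le }
  have hw : ∀ r, ∑ i, Z.weight r i = 1 := fun r => (hprof r).sum_weight
  have hRs := isSimpleMap_finalRounds (v := v) hA hT.round_le
  refine ⟨ℕ → unitInterval, (ℕ × (ℕ → ℕ)) × unitInterval, inferInstance, inferInstance,
    uniformSeq, inferInstance, fun ω => localFun Z (finalRounds Z v A ω), stochGrad Z,
    randomElement Z v A, ?_, ?_, ?_, ?_, ?_, ?_⟩
  · exact fun i x => (hRs.comp fun R => localFun Z R i x).measurable
  · exact fun k => (((isSimpleMap_sim k).comp fun S => S.2.1).measurable.prodMk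
      hRs.measurable).prodMk (measurable_pi_apply k)
  · exact fun ω i => differentiable_chainFun _ _ _
  · intro ω
    rw [average_localFun hn hw]
    refine isAdmissible_chainFun hscale hlam (le_of_eq ?_) ?_
    · change 30 * (1920 * ε / L) * (240 * √ε / L)⁻¹ ^ 2 = L
      field_simp
      rw [hsq]
      ring
    · change 1920 * ε / L * (4 * (((2 * K : ℕ) : ℝ) + 1)) ≤ Δ
      have hK1' : (1 : ℝ) ≤ K := by exact_mod_cast hK1
      calc 1920 * ε / L * (4 * (((2 * K : ℕ) : ℝ) + 1))
          ≤ 1920 * ε / L * (12 * (1 / 23040 * (L * Δ / ε))) := by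
            refine mul_le_mul_of_nonneg_left ?_ (by positivity)
            push_cast
            linarith
        _ = Δ := by field_simp; norm_num
  · exact unbiasedBoundedVariance hA hZ hT.round_le
  · exact lowerBound_of_profile hn hA hε hZ hT hw rfl (lowerTime_pos hn hv hK1) hscale hlam hgrad
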